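/- Let $(F_d)_{d\in\mathbb Z}$ be an $\Omega$-spectrum, i.e. a sequence of pointed topological spaces together with pointed homotopy equivalences $F_d\simeq\Omega F_{d+1}$. For a space $X$ let $h^d(X)=[X,F_d]$ be the set of homotopy classes of maps $X\to F_d$, and for a pointed space $X$ let $\tilde h^d(X)=\langle X,F_d\rangle$ be the set of pointed homotopy classes of pointed maps $X\to F_d$; both are abelian groups under concatenation of loops, via $F_d\simeq\Omega F_{d+1}$, and are contravariantly functorial by precomposition. "Group" means CW-group: a topological group with a CW structure such that inversion maps $n$-cells to $n$-cells and the product of a point of an $m$-cell and a point of an $n$-cell lies in a cell of dimension at most $m+n$ (for example any discrete group); homomorphisms are continuous. Let $B$ be the classifying space functor from groups to pointed spaces given by geometric realization of the bar construction (products taken in compactly generated spaces), and let $0$ be the trivial group. For every $d\in\mathbb Z$ and every group $G$ there is a split short exact sequence of abelian groups $$0\longrightarrow \tilde h^d(BG)\xrightarrow{\ i\ } h^d(BG)\xrightarrow{\ p\ } h^d(B0)\longrightarrow 0,\qquad p\circ s=\mathrm{id},$$ where $i$ forgets basepoints, $p$ is induced by $0\hookrightarrow G$, and the splitting $s:h^d(B0)\to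 h^d(BG)$ is induced by $G\twoheadrightarrow 0$. The maps $i,p,s$ are natural with respect to homomorphisms $G'\to G$. Consequently there is an isomorphism $$h^d(BG)\cong\tilde h^d(BG)\oplus h^d(B0),$$ natural in $G$, whose inverse is $(a,b)\mapsto i(a)+s(b)$ and whose second component is $p$. Likewise there is an isomorphism $h^d(BG)\cong\tilde h^d(BG)\oplus h^d(\mathrm{pt})$, natural in $G$, whose second component is restriction to the basepoint of $BG$ and whose inverse is $(a,b)\mapsto i(a)+c^*(b)$, where $c:BG\to\mathrm{pt}$ is the unique map. -/

import Mathlib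

open Topology unitInterval

universe u v w

noncomputable section

namespace GenCoh

/-! ### Homotopy classes of maps of pairs

`Maps A y₀` is the set of (continuous) maps `f : X → Y` sending every point of `A ⊆ X` to the
basepoint `y₀`, and `Htpy A y₀` is its quotient by homotopy relative to `A`.
For `A = ∅` this is the set `[X, Y]` of free homotopy classes of maps; for `A = {x₀}` it is the set
`⟨X, Y⟩` of pointed homotopy classes of pointed maps `(X, x₀) → (Y, y₀)`. -/

section Htpy

variable {X : Type u} [TopologicalSpace X] {Y : Type v} [TopologicalSpace Y]
  {Z : Type w} [TopologicalSpace Z]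

/-- Maps `X → Y` sending `A` to the basepoint `y₀`. -/
def Maps (A : Set X) (y₀ : Y) : Type (max u v) := {f : C(X, Y) // ∀ a ∈ A, f a = y₀}

/-- Homotopy relative to `A`. -/
instance mapsSetoid (A : Set X) (y₀ : Y) : Setoid (Maps A y₀) where
  r f g := ContinuousMap.HomotopicRel f.1 g.1 A
  iseqv := ⟨fun f => .refl f.1, fun h => h.symm, fun h k => h.trans k⟩

/-- Homotopy classes, relative to `A`, of maps `X → Y` sending `A` to `y₀`. -/
def Htpy (A : Set X) (y₀ : Y) : Type (max u v) := Quotient (mapsSetoid A y₀)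

/-- The class `[f]` of a map `f`. -/
def Htpy.mk {A : Set X} {y₀ : Y} (f : Maps A y₀) : Htpy A y₀ := Quotient.mk _ f

theorem Htpy.sound {A : Set X} {y₀ : Y} {f g : Maps A y₀}
    (h : ContinuousMap.HomotopicRel f.1 g.1 A) : Htpy.mk f = Htpy.mk g := Quotient.sound h

theorem Htpy.exact {A : Set X} {y₀ : Y} {f g : Maps A y₀}
    (h : Htpy.mk f = Htpy.mk g) : ContinuousMap.HomotopicRel f.1 g.1 A := Quotient.exact h

theorem Htpy.ind {A : Set X} {y₀ : Y} {P : Htpy A y₀ → Prop} (h : ∀ f, P (Htpy.mk f)) (x) : P x :=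
  Quotient.ind h x

/-- An explicit homotopy `H : I × X → Y` that is constant at `y₀` on `A` identifies classes. -/
theorem Htpy.sound' {A : Set X} {y₀ : Y} {f g : Maps A y₀} (H : I → X → Y)
    (hH : Continuous fun p : I × X => H p.1 p.2) (h0 : ∀ x, H 0 x = f.1 x)
    (h1 : ∀ x, H 1 x = g.1 x) (hA : ∀ t, ∀ a ∈ A, H t a = y₀) : Htpy.mk f = Htpy.mk g :=
  Htpy.sound ⟨{ toFun := fun p => H p.1 p.2
                continuous_toFun := hH
                map_zero_left := h0
                map_one_left := h1
                prop' := fun t a ha => (hA t a ha).trans (f.2 a ha).symm }⟩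

/-- Postcomposition `[c] ↦ [φ ∘ c]` with a pointed map `φ : (Y, y₀) → (Z, z₀)`. -/
def post (A : Set X) {y₀ : Y} {z₀ : Z} (φ : C(Y, Z)) (hφ : φ y₀ = z₀) :
    Htpy A y₀ → Htpy A z₀ :=
  Quotient.map (fun f => ⟨φ.comp f.1, fun a ha => by simp [f.2 a ha, hφ]⟩)
    fun _ _ h => h.comp_continuousMap φ

theorem post_post (A : Set X) {W : Type*} [TopologicalSpace W] {y₀ : Y} {z₀ : Z} {w₀ : W}
    (φ : C(Y, Z)) (hφ : φ y₀ = z₀) (ψ : C(Z, W)) (hψ : ψ z₀ = w₀) (x : Htpy A y₀) :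
    post A ψ hψ (post A φ hφ x) = post A (ψ.comp φ) (by simp [hφ, hψ]) x := by
  induction x using Htpy.ind with
  | h f => rfl

theorem post_congr (A : Set X) {y₀ : Y} {z₀ : Z} {φ ψ : C(Y, Z)} (hφ : φ y₀ = z₀) (hψ : ψ y₀ = z₀)
    (h : ContinuousMap.HomotopicRel φ ψ {y₀}) (x : Htpy A y₀) :
    post A φ hφ x = post A ψ hψ x := by
  obtain ⟨H⟩ := h
  induction x using Htpy.ind with
  | h f =>
    refine Htpy.sound' (fun t x => H (t, f.1 x)) (by fun_prop) (by simp) (by simp) ?_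
    intro t a ha
    rw [f.2 a ha, H.eq_fst t (Set.mem_singleton _), hφ]

theorem post_id (A : Set X) {y₀ : Y} (x : Htpy A y₀) : post A (.id Y) rfl x = x := by
  induction x using Htpy.ind with
  | h f => rfl

/-- Precomposition `[c] ↦ [c ∘ f]` with a map of pairs `f : (X', A') → (X, A)`. -/
def pre {X' : Type w} [TopologicalSpace X'] {A' : Set X'} {A : Set X} (y₀ : Y) (f : C(X', X))
    (hf : Set.MapsTo f A' A) : Htpy A y₀ → Htpy A' y₀ :=
  Quotient.map (fun c => ⟨c.1.comp f, fun a ha => c.2 _ (hf ha)⟩) <| by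
    rintro c₀ c₁ ⟨H⟩
    exact ⟨{ toFun := fun p => H (p.1, f p.2)
             continuous_toFun := by fun_prop
             map_zero_left := by simp
             map_one_left := by simp
             prop' := fun t a ha => by simp [H.eq_fst t (hf ha)] }⟩

end Htpy

/-! ### Loop spaces and concatenation of loops

The loop space `ΩY` of `(Y, y₀)` is `Path y₀ y₀` with the compact-open topology, with the constant
loop `Path.refl y₀` as its basepoint. -/

section Loop

variable {X : Type u} [TopologicalSpace X] {Y : Type v} [TopologicalSpace Y]
  {Z : Type w} [TopologicalSpace Z]

/-- The map `Ωφ : ΩY → ΩZ` induced by a pointed map `φ`. -/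
def loopMap {y₀ : Y} {z₀ : Z} (φ : C(Y, Z)) (hφ : φ y₀ = z₀) : C(Path y₀ y₀, Path z₀ z₀) where
  toFun p := (p.map φ.continuous).cast hφ.symm hφ.symm
  continuous_toFun := Path.continuous_uncurry_iff.mp <|
    φ.continuous.comp (continuous_eval (F := Path y₀ y₀))

theorem loopMap_apply {y₀ : Y} {z₀ : Z} (φ : C(Y, Z)) (hφ : φ y₀ = z₀) (p : Path y₀ y₀) (s : I) :
    loopMap φ hφ p s = φ (p s) := rfl

theorem loopMap_refl {y₀ : Y} {z₀ : Z} (φ : C(Y, Z)) (hφ : φ y₀ = z₀) :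
    loopMap φ hφ (Path.refl y₀) = Path.refl z₀ := by
  ext s; exact hφ

theorem loopMap_homotopicRel {y₀ : Y} {z₀ : Z} {φ ψ : C(Y, Z)} (hφ : φ y₀ = z₀) (hψ : ψ y₀ = z₀)
    (h : ContinuousMap.HomotopicRel φ ψ {y₀}) :
    ContinuousMap.HomotopicRel (loopMap φ hφ) (loopMap ψ hψ) {Path.refl y₀} := by
  obtain ⟨H⟩ := h
  have key : ∀ t, H (t, y₀) = z₀ := fun t => by rw [H.eq_fst t (Set.mem_singleton _), hφ]
  refine ⟨{ toFun := fun q =>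
              { toFun := fun s => H (q.1, q.2 s)
                continuous_toFun := by fun_prop
                source' := by simp [key]
                target' := by simp [key] }
            continuous_toFun := Path.continuous_uncurry_iff.mp ?_
            map_zero_left := fun p => by ext s; simp [loopMap_apply]
            map_one_left := fun p => by ext s; simp [loopMap_apply]
            prop' := ?_ }⟩
  · exact H.continuous.comp ((continuous_fst.comp continuous_fst).prodMk
      ((continuous_eval (F := Path y₀ y₀)).comp
        ((continuous_snd.comp continuous_fst).prodMk continuous_snd)))
  · rintro t p rfl
    ext s
    simp [loopMap_apply, key, hφ]

variable {A : Set X} {y₀ : Y}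

/-- Pointwise concatenation of two maps into a loop space. -/
def Maps.concat (f g : Maps A (Path.refl y₀)) : Maps A (Path.refl y₀) :=
  ⟨⟨fun x => (f.1 x).trans (g.1 x),
    Path.continuous_trans.comp (f.1.continuous.prodMk g.1.continuous)⟩,
    fun a ha => by simp [f.2 a ha, g.2 a ha]⟩

/-- Pointwise reversal of a map into a loop space. -/
def Maps.rev (f : Maps A (Path.refl y₀)) : Maps A (Path.refl y₀) :=
  ⟨⟨fun x => (f.1 x).symm, Path.continuous_symm.comp f.1.continuous⟩,
    fun a ha => by simp [f.2 a ha]⟩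

/-- The constant map at the basepoint. -/
def Maps.const (A : Set X) (y₀ : Y) : Maps A y₀ := ⟨ContinuousMap.const X y₀, fun _ _ => rfl⟩

instance : Zero (Htpy A (Path.refl y₀)) := ⟨Htpy.mk (Maps.const A _)⟩

/-- `[c₁] + [c₂]` is the class of the pointwise concatenation of loops. -/
instance : Add (Htpy A (Path.refl y₀)) :=
  ⟨Quotient.map₂ Maps.concat <| by
    rintro f f' ⟨H⟩ g g' ⟨K⟩
    exact ⟨{ toFun := fun p => (H p).trans (K p)
             continuous_toFun := Path.continuous_trans.comp (H.continuous.prodMk K.continuous)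
             map_zero_left := fun x => by simp [Maps.concat]
             map_one_left := fun x => by simp [Maps.concat]
             prop' := fun t a ha => by
              simp [Maps.concat, H.eq_fst t ha, K.eq_fst t ha] }⟩⟩

instance : Neg (Htpy A (Path.refl y₀)) :=
  ⟨Quotient.map Maps.rev <| by
    rintro f f' ⟨H⟩
    exact ⟨{ toFun := fun p => (H p).symm
             continuous_toFun := Path.continuous_symm.comp H.continuous
             map_zero_left := fun x => by simp [Maps.rev]
             map_one_left := fun x => by simp [Maps.rev]
             prop' := fun t a ha => by simp [Maps.rev, H.eq_fst t ha] }⟩⟩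

theorem Htpy.mk_add (f g : Maps A (Path.refl y₀)) :
    Htpy.mk f + Htpy.mk g = Htpy.mk (f.concat g) := rfl

theorem Htpy.neg_mk (f : Maps A (Path.refl y₀)) : -Htpy.mk f = Htpy.mk f.rev := rfl

theorem Htpy.zero_def : (0 : Htpy A (Path.refl y₀)) = Htpy.mk (Maps.const A _) := rfl

/-- Reparametrizing all loops by a family `ρ t : I → I` with endpoints sent to endpoints gives a
homotopy. -/
theorem Htpy.sound_reparam (f g₀ g₁ : Maps A (Path.refl y₀)) (ρ : I × I → I) (hρ : Continuous ρ)
    (hs : ∀ t, ρ (t, 0) = 0 ∨ ρ (t, 0) = 1) (ht : ∀ t, ρ (t, 1) = 0 ∨ ρ (t, 1) = 1)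
    (h0 : ∀ x s, f.1 x (ρ (0, s)) = g₀.1 x s) (h1 : ∀ x s, f.1 x (ρ (1, s)) = g₁.1 x s) :
    Htpy.mk g₀ = Htpy.mk g₁ := by
  refine Htpy.sound' (fun t x =>
    { toFun := fun s => f.1 x (ρ (t, s))
      continuous_toFun := by fun_prop
      source' := by rcases hs t with h | h <;> simp [h]
      target' := by rcases ht t with h | h <;> simp [h] })
    (Path.continuous_uncurry_iff.mp ?_) (fun x => Path.ext (funext fun s => h0 x s))
    (fun x => Path.ext (funext fun s => h1 x s)) ?_
  · exact (continuous_eval (F := Path y₀ y₀)).comp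
      ((f.1.continuous.comp (continuous_snd.comp continuous_fst)).prodMk
        (hρ.comp ((continuous_fst.comp continuous_fst).prodMk continuous_snd)))
  · intro t a ha
    ext s
    simp [f.2 a ha]

theorem delayReflLeft_refl (t : I) :
    Path.delayReflLeft t (Path.refl y₀) = Path.refl y₀ := by ext s; rfl

theorem delayReflRight_refl (t : I) :
    Path.delayReflRight t (Path.refl y₀) = Path.refl y₀ := by ext s; rfl

/-- Homotopy classes of maps into a loop space form a group under concatenation. -/
instance : AddGroup (Htpy A (Path.refl y₀)) :=
  AddGroup.ofLeftAxioms
    (by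
      intro a b c
      induction a using Htpy.ind with | h f => ?_
      induction b using Htpy.ind with | h g => ?_
      induction c using Htpy.ind with | h k => ?_
      rw [Htpy.mk_add, Htpy.mk_add, Htpy.mk_add, Htpy.mk_add]
      let φ : I → I := fun s =>
        ⟨Path.Homotopy.transAssocReparamAux s, Path.Homotopy.transAssocReparamAux_mem_I s⟩
      have hφ : Continuous φ :=
        Path.Homotopy.continuous_transAssocReparamAux.subtype_mk _
      refine Htpy.sound_reparam (f.concat (g.concat k)) _ _
        (fun p => ⟨(1 - (p.1 : ℝ)) * φ p.2 + p.1 * p.2, ?_⟩) ?_ ?_ ?_ ?_ ?_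
      · have h1 := p.1.2; have h2 := p.2.2; have h3 := (φ p.2).2
        exact (convex_Icc (0 : ℝ) 1) h3 h2 (sub_nonneg.2 h1.2) h1.1 (by ring)
      · fun_prop
      · intro t; left; ext
        simp [φ, Path.Homotopy.transAssocReparamAux_zero]
      · intro t; right; ext
        simp [φ, Path.Homotopy.transAssocReparamAux_one]
      · intro x s
        have := congrArg (fun p : Path y₀ y₀ => p s)
          (Path.Homotopy.trans_assoc_reparam (f.1 x) (g.1 x) (k.1 x))
        simp only [Path.coe_reparam, Function.comp] at this
        simpa [Maps.concat, φ] using this.symm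
      · intro x s
        simp)
    (by
      intro a
      induction a using Htpy.ind with | h f => ?_
      rw [Htpy.zero_def, Htpy.mk_add]
      refine Htpy.sound' (fun t x => Path.delayReflLeft t (f.1 x))
        (Path.continuous_delayReflLeft.comp
          (continuous_fst.prodMk (f.1.continuous.comp continuous_snd))) ?_ ?_ ?_
      · intro x; rw [Path.delayReflLeft_zero]; rfl
      · intro x; rw [Path.delayReflLeft_one]
      · intro t a ha; rw [f.2 a ha, delayReflLeft_refl])
    (by
      intro a
      induction a using Htpy.ind with | h f => ?_
      rw [Htpy.zero_def, Htpy.neg_mk, Htpy.mk_add]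
      refine Htpy.sound_reparam f.rev _ _
        (fun p => ⟨Path.Homotopy.reflTransSymmAux (σ p.1, p.2),
          Path.Homotopy.reflTransSymmAux_mem_I _⟩) ?_ ?_ ?_ ?_ ?_
      · exact (Path.Homotopy.continuous_reflTransSymmAux.comp (by fun_prop)).subtype_mk _
      · intro t; left; ext; simp [Path.Homotopy.reflTransSymmAux]
      · intro t; left; ext; norm_num [Path.Homotopy.reflTransSymmAux]
      · intro x s
        have := (Path.Homotopy.reflTransSymm (f.rev.1 x)).apply_one s
        simp only [unitInterval.symm_zero]
        refine Eq.trans this ?_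
        simp [Maps.concat, Maps.rev]
      · intro x s
        simp [Path.Homotopy.reflTransSymmAux, Maps.const])

theorem post_loopMap_add {z₀ : Z} (φ : C(Y, Z)) (hφ : φ y₀ = z₀) (a b : Htpy A (Path.refl y₀)) :
    post A (loopMap φ hφ) (loopMap_refl φ hφ) (a + b) =
      post A (loopMap φ hφ) (loopMap_refl φ hφ) a + post A (loopMap φ hφ) (loopMap_refl φ hφ) b := by
  induction a using Htpy.ind with | h f => ?_
  induction b using Htpy.ind with | h g => ?_
  refine congrArg Htpy.mk (Subtype.ext (ContinuousMap.ext fun x => Path.ext (funext fun s => ?_)))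
  simp only [Maps.concat, ContinuousMap.comp_apply, ContinuousMap.coe_mk, loopMap_apply,
    Path.trans_apply]
  split_ifs <;> rfl

/-- In a double loop space, concatenation in the inner loop coordinate. -/
def Maps.inner (f g : Maps A (Path.refl (Path.refl y₀))) : Maps A (Path.refl (Path.refl y₀)) :=
  ⟨⟨fun x =>
    { toFun := fun s => (f.1 x s).trans (g.1 x s)
      continuous_toFun :=
        Path.continuous_trans.comp ((f.1 x).continuous.prodMk (g.1 x).continuous)
      source' := by simp
      target' := by simp },
    Path.continuous_uncurry_iff.mp <| Path.continuous_trans.comp <|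
      ((continuous_eval (F := Path (Path.refl y₀) (Path.refl y₀))).comp
        (f.1.continuous.prodMap continuous_id)).prodMk
      ((continuous_eval (F := Path (Path.refl y₀) (Path.refl y₀))).comp
        (g.1.continuous.prodMap continuous_id))⟩,
    fun a ha => by ext s : 2; simp [f.2 a ha, g.2 a ha]⟩

theorem Maps.inner_apply (f g : Maps A (Path.refl (Path.refl y₀))) (x : X) (s : I) :
    (f.inner g).1 x s = (f.1 x s).trans (g.1 x s) := rfl

/-- Concatenation in the inner loop coordinate, on homotopy classes. -/
def inner : Htpy A (Path.refl (Path.refl y₀)) → Htpy A (Path.refl (Path.refl y₀)) →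
    Htpy A (Path.refl (Path.refl y₀)) :=
  Quotient.map₂ Maps.inner <| by
    rintro f f' ⟨H⟩ g g' ⟨K⟩
    refine Htpy.exact (Htpy.sound' (fun t x =>
      { toFun := fun s => (H (t, x) s).trans (K (t, x) s)
        continuous_toFun :=
          Path.continuous_trans.comp ((H (t, x)).continuous.prodMk (K (t, x)).continuous)
        source' := by simp
        target' := by simp }) (Path.continuous_uncurry_iff.mp ?_) ?_ ?_ ?_)
    · exact Path.continuous_trans.comp <|
        ((continuous_eval (F := Path (Path.refl y₀) (Path.refl y₀))).comp
          (H.continuous.prodMap continuous_id)).prodMk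
        ((continuous_eval (F := Path (Path.refl y₀) (Path.refl y₀))).comp
          (K.continuous.prodMap continuous_id))
    · intro x; ext s : 2; simp [Maps.inner_apply]
    · intro x; ext s : 2; simp [Maps.inner_apply]
    · intro t a ha; ext s : 2
      simp [H.eq_fst t ha, K.eq_fst t ha, f.2 a ha, g.2 a ha]

theorem inner_isUnital : EckmannHilton.IsUnital (inner (A := A) (y₀ := y₀)) 0 where
  left_id a := by
    induction a using Htpy.ind with | h f => ?_
    refine Htpy.sound' (fun t x =>
      { toFun := fun s => Path.delayReflLeft t (f.1 x s)
        continuous_toFun := Path.continuous_delayReflLeft.comp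
          (continuous_const.prodMk (f.1 x).continuous)
        source' := by simp [delayReflLeft_refl]
        target' := by simp [delayReflLeft_refl] }) (Path.continuous_uncurry_iff.mp ?_) ?_ ?_ ?_
    · exact Path.continuous_delayReflLeft.comp ((continuous_fst.comp continuous_fst).prodMk
        ((continuous_eval (F := Path (Path.refl y₀) (Path.refl y₀))).comp
          ((f.1.continuous.comp continuous_snd).prodMap continuous_id)))
    · intro x; ext s : 2; exact Path.delayReflLeft_zero _
    · intro x; ext s : 2; exact Path.delayReflLeft_one _
    · intro t a ha; ext s : 2; simp [f.2 a ha, delayReflLeft_refl]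
  right_id a := by
    induction a using Htpy.ind with | h f => ?_
    refine Htpy.sound' (fun t x =>
      { toFun := fun s => Path.delayReflRight t (f.1 x s)
        continuous_toFun := Path.continuous_delayReflRight.comp
          (continuous_const.prodMk (f.1 x).continuous)
        source' := by simp [delayReflRight_refl]
        target' := by simp [delayReflRight_refl] }) (Path.continuous_uncurry_iff.mp ?_) ?_ ?_ ?_
    · exact Path.continuous_delayReflRight.comp ((continuous_fst.comp continuous_fst).prodMk
        ((continuous_eval (F := Path (Path.refl y₀) (Path.refl y₀))).comp
          ((f.1.continuous.comp continuous_snd).prodMap continuous_id)))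
    · intro x; ext s : 2; exact Path.delayReflRight_zero _
    · intro x; ext s : 2; exact Path.delayReflRight_one _
    · intro t a ha; ext s : 2; simp [f.2 a ha, delayReflRight_refl]

theorem inner_distrib (a b c d : Htpy A (Path.refl (Path.refl y₀))) :
    inner (a + b) (c + d) = inner a c + inner b d := by
  induction a using Htpy.ind with | h f => ?_
  induction b using Htpy.ind with | h g => ?_
  induction c using Htpy.ind with | h k => ?_
  induction d using Htpy.ind with | h l => ?_
  refine congrArg Htpy.mk (Subtype.ext (ContinuousMap.ext fun x => Path.ext (funext fun s => ?_)))
  rw [Maps.inner_apply]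
  simp only [Maps.concat, ContinuousMap.coe_mk, Path.trans_apply]
  split_ifs <;> rfl

/-- Addition of classes of maps into a double loop space is commutative. -/
theorem add_comm_double (a b : Htpy A (Path.refl (Path.refl y₀))) : a + b = b + a :=
  (EckmannHilton.addCommGroup inner_isUnital inner_distrib).add_comm a b

end Loop

/-! ### Ω-spectra and the cohomology theories they define -/

/-- A pointed map `φ : (Y, y₀) → (Z, z₀)` is a pointed homotopy equivalence: it has an inverse up
to pointed homotopy. -/
structure IsPointedHomotopyEquiv {Y : Type u} [TopologicalSpace Y] {Z : Type v}
    [TopologicalSpace Z] (y₀ : Y) (z₀ : Z) (φ : C(Y, Z)) : Prop where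
  map_pt : φ y₀ = z₀
  exists_inverse : ∃ ψ : C(Z, Y), ψ z₀ = y₀ ∧
    ContinuousMap.HomotopicRel (ψ.comp φ) (.id Y) {y₀} ∧
    ContinuousMap.HomotopicRel (φ.comp ψ) (.id Z) {z₀}

/-- An Ω-spectrum: pointed spaces `F d`, `d ∈ ℤ`, together with pointed homotopy equivalences
`F d ≃ Ω F (d + 1)`. -/
structure OmegaSpectrum where
  /-- The spaces of the spectrum. -/
  space : ℤ → Type v
  [top : ∀ d, TopologicalSpace (space d)]
  /-- The basepoints. -/
  pt : ∀ d, space d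
  /-- The structure maps. -/
  str : ∀ d, C(space d, Path (pt (d + 1)) (pt (d + 1)))
  isEquiv : ∀ d, IsPointedHomotopyEquiv (pt d) (Path.refl (pt (d + 1))) (str d)

attribute [instance] OmegaSpectrum.top

namespace OmegaSpectrum

variable (F : OmegaSpectrum.{v}) (d : ℤ)

/-- Classes of maps into `F d` that send `A ⊆ X` to the basepoint, modulo homotopy
relative to `A`. -/
def Coh {X : Type u} [TopologicalSpace X] (A : Set X) : Type (max u v) := Htpy A (F.pt d)

/-- The unreduced theory `h^d(X) = [X, F d]`. -/
abbrev Unreduced (X : Type u) [TopologicalSpace X] : Type (max u v) := F.Coh d (∅ : Set X)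

/-- The reduced theory `h̃^d(X) = ⟨X, F d⟩` of a pointed space `(X, x₀)`. -/
abbrev Reduced (X : Type u) [TopologicalSpace X] (x₀ : X) : Type (max u v) :=
  F.Coh d ({x₀} : Set X)

variable {X : Type u} [TopologicalSpace X] (A : Set X)

/-- The bijection `[X, F d] ≈ [X, Ω F (d + 1)]` (and its relative version) given by composition
with the structure map. -/
def deloop : F.Coh d A ≃ Htpy A (Path.refl (F.pt (d + 1))) where
  toFun := post A (F.str d) (F.isEquiv d).map_pt
  invFun := post A (F.isEquiv d).exists_inverse.choose
    (F.isEquiv d).exists_inverse.choose_spec.1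
  left_inv x := (post_post A _ _ _ _ x).trans <| (post_congr A _ rfl
    (F.isEquiv d).exists_inverse.choose_spec.2.1 x).trans (post_id A x)
  right_inv x := (post_post A _ _ _ _ x).trans <| (post_congr A _ rfl
    (F.isEquiv d).exists_inverse.choose_spec.2.2 x).trans (post_id A x)

theorem loop_deloop_injective : Function.Injective
    (post A (loopMap (F.str (d + 1)) (F.isEquiv (d + 1)).map_pt)
      (loopMap_refl (F.str (d + 1)) (F.isEquiv (d + 1)).map_pt)) := by
  obtain ⟨h, ψ, hψ, h1, -⟩ := F.isEquiv (d + 1)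
  refine Function.LeftInverse.injective (g := post A (loopMap ψ hψ) (loopMap_refl ψ hψ)) fun x => ?_
  rw [post_post]
  exact (post_congr A _ rfl (loopMap_homotopicRel (by simp [h, hψ]) rfl h1) x).trans (post_id A x)

theorem add_comm_loop (a b : Htpy A (Path.refl (F.pt (d + 1)))) : a + b = b + a := by
  apply F.loop_deloop_injective d A
  rw [post_loopMap_add, post_loopMap_add]
  exact add_comm_double _ _

/-- The abelian group structure: under `[X, F d] ≈ [X, Ω F (d + 1)]`, addition is
concatenation of loops. -/
instance : AddCommGroup (F.Coh d A) :=
  { (F.deloop d A).addGroup with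
    add_comm := fun a b => (F.deloop d A).injective <| by
      change F.deloop d A ((F.deloop d A).symm _) = F.deloop d A ((F.deloop d A).symm _)
      rw [F.add_comm_loop d A] }

variable {A}

theorem deloop_add (a b : F.Coh d A) :
    F.deloop d A (a + b) = F.deloop d A a + F.deloop d A b :=
  (F.deloop d A).apply_symm_apply _

/-- The homomorphism `f^* : [c] ↦ [c ∘ f]` induced by a map of pairs `f : (X', A') → (X, A)`. -/
def pullback {X' : Type w} [TopologicalSpace X'] {A' : Set X'} (f : C(X', X))
    (hf : Set.MapsTo f A' A) : F.Coh d A →+ F.Coh d A' :=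
  AddMonoidHom.mk' (pre (F.pt d) f hf) fun a b => by
    have key : ∀ x : F.Coh d A,
        F.deloop d A' (pre (F.pt d) f hf x) = pre _ f hf (F.deloop d A x) := fun x => by
      induction x using Htpy.ind with
      | h c => rfl
    have hadd : ∀ x y : Htpy A (Path.refl (F.pt (d + 1))),
        pre _ f hf (x + y) = pre _ f hf x + pre _ f hf y := fun x y => by
      induction x using Htpy.ind with | h c => ?_
      induction y using Htpy.ind with | h c' => ?_
      rfl
    refine (F.deloop d A').injective ((key _).trans ?_)
    rw [deloop_add, hadd, ← key, ← key]
    exact (F.deloop_add d _ _).symm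

/-- The homomorphism `f^* : h^d(X) → h^d(X')` induced by a map `f : X' → X`. -/
def unreducedMap {X' : Type w} [TopologicalSpace X'] (f : C(X', X)) :
    F.Unreduced d X →+ F.Unreduced d X' :=
  F.pullback d f (Set.mapsTo_empty f ∅)

/-- The homomorphism `f^* : h̃^d(X) → h̃^d(X')` induced by a pointed map
`f : (X', x₀') → (X, x₀)`. -/
def reducedMap {X' : Type w} [TopologicalSpace X'] {x₀' : X'} {x₀ : X} (f : C(X', X))
    (hf : f x₀' = x₀) : F.Reduced d X x₀ →+ F.Reduced d X' x₀' :=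
  F.pullback d f (by simp [Set.MapsTo, hf])

/-- Forgetting basepoints: `h̃^d(X) → h^d(X)` sends the pointed homotopy class of a pointed
map to its free homotopy class. -/
def forget (x₀ : X) : F.Reduced d X x₀ →+ F.Unreduced d X :=
  F.pullback d (.id X) (Set.mapsTo_empty _ _)

end OmegaSpectrum

/-! ### CW-groups -/

open Topology in
/-- A CW-group: a CW-complex with a topological group structure such that inversion sends
`n`-cells to `n`-cells and the product of points of an `n₁`-cell and of an `n₂`-cell lies in a cell
of dimension at most `n₁ + n₂`. -/
structure CWGrp where
  /-- The underlying type. -/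
  carrier : Type u
  [group : Group carrier]
  [top : TopologicalSpace carrier]
  [isTopologicalGroup : IsTopologicalGroup carrier]
  [t2 : T2Space carrier]
  [cw : CWComplex (Set.univ : Set carrier)]
  inv_cell : ∀ (n : ℕ) (i : RelCWComplex.cell (Set.univ : Set carrier) n),
    ∃ j : RelCWComplex.cell (Set.univ : Set carrier) n,
      (fun g : carrier => g⁻¹) '' RelCWComplex.openCell n i = RelCWComplex.openCell n j
  mul_cell : ∀ (n₁ n₂ : ℕ) (i₁ : RelCWComplex.cell (Set.univ : Set carrier) n₁)
    (i₂ : RelCWComplex.cell (Set.univ : Set carrier) n₂),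
    ∀ g₁ ∈ RelCWComplex.openCell n₁ i₁, ∀ g₂ ∈ RelCWComplex.openCell n₂ i₂,
      ∃ m ≤ n₁ + n₂, ∃ j : RelCWComplex.cell (Set.univ : Set carrier) m,
        g₁ * g₂ ∈ RelCWComplex.openCell m j

instance : CoeSort CWGrp.{u} (Type u) := ⟨CWGrp.carrier⟩

attribute [instance] CWGrp.group CWGrp.top CWGrp.isTopologicalGroup CWGrp.t2 CWGrp.cw

theorem discrete_cell_eq_zero {G : Type u} [TopologicalSpace G] [DiscreteTopology G] (n : ℕ)
    (i : RelCWComplex.cell (Set.univ : Set G) n) : n = 0 := by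
  cases n with
  | zero => rfl
  | succ n => exact i.elim

theorem discrete_openCell {G : Type u} [TopologicalSpace G] [DiscreteTopology G]
    (i : RelCWComplex.cell (Set.univ : Set G) 0) : RelCWComplex.openCell 0 i = {(i.1 : G)} := by
  have h : ∀ x, RelCWComplex.map (C := (Set.univ : Set G)) 0 i x = i.1 := fun _ => rfl
  ext g
  simp only [RelCWComplex.openCell, Set.mem_image, h, Set.mem_singleton_iff]
  exact ⟨fun ⟨_, _, e⟩ => e.symm, fun e => ⟨0, by simp, e.symm⟩⟩

/-- A discrete group as a CW-group, all of whose elements are 0-cells. -/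
def CWGrp.ofDiscrete (G : Type u) [Group G] [TopologicalSpace G] [DiscreteTopology G] :
    CWGrp.{u} where
  carrier := G
  inv_cell n i := by
    obtain rfl := discrete_cell_eq_zero n i
    exact ⟨⟨(i.1 : G)⁻¹, trivial⟩, by rw [discrete_openCell, discrete_openCell]; simp⟩
  mul_cell n₁ n₂ i₁ i₂ g₁ _ g₂ _ :=
    ⟨0, Nat.zero_le _, (⟨g₁ * g₂, trivial⟩ : (Set.univ : Set G)), by rw [discrete_openCell]; rfl⟩

/-- The trivial group `0`. -/
def CWGrp.zero : CWGrp.{u} := CWGrp.ofDiscrete PUnit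

/-! ### The classifying space functor

For a topological group `G`, let `E G` be the geometric realization of the simplicial space with
`n`-simplices `G^(n+1)`, in which `θ : [m] → [n]` acts by `g ↦ g ∘ θ`, and let `B G` be the orbit
space of the translation action of `G` on `E G`. Equivalently, `B G` is the geometric realization of
the nerve (bar construction) of `G`. Products are formed in compactly generated spaces. -/

section Classifying

/-- The disjoint union of the spaces `G^(n+1) × Δ^n`, where `G^(n+1)` has the compactly generated
product topology. -/
abbrev PreB (G : Type u) [TopologicalSpace G] : Type u :=
  Σ n : ℕ, CompactCoherentification (Fin (n + 1) → G) × stdSimplex ℝ (Fin (n + 1))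

/-- The point of `PreB G` given by `g ∈ G^(n+1)` and `t ∈ Δ^n`. -/
def PreB.mk {G : Type u} [TopologicalSpace G] {n : ℕ} (g : Fin (n + 1) → G)
    (t : stdSimplex ℝ (Fin (n + 1))) : PreB G :=
  ⟨n, CompactCoherentification.mk _ g, t⟩

/-- The identifications defining `B G`: those of the geometric realization,
`(θ^* g, t) ∼ (g, θ_* t)`, and those of the orbit space, `(g, t) ∼ (a g, t)`. -/
inductive BRel (G : Type u) [Group G] [TopologicalSpace G] : PreB G → PreB G → Prop
  | simplicial {m n : ℕ} (θ : Fin (m + 1) →o Fin (n + 1)) (g : Fin (n + 1) → G)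
      (t : stdSimplex ℝ (Fin (m + 1))) :
      BRel G (PreB.mk (fun k => g (θ k)) t) (PreB.mk g (stdSimplex.map θ t))
  | translate {n : ℕ} (a : G) (g : Fin (n + 1) → G) (t : stdSimplex ℝ (Fin (n + 1))) :
      BRel G (PreB.mk g t) (PreB.mk (fun k => a * g k) t)

variable (G : Type u) [Group G] [TopologicalSpace G]

/-- The classifying space `B G`, with the quotient topology. -/
def B : Type u := Quot (BRel G)

instance : TopologicalSpace (B G) := inferInstanceAs (TopologicalSpace (Quot (BRel G)))

/-- The basepoint of `B G`: its unique vertex. -/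
def B.pt : B G := Quot.mk _ (PreB.mk (n := 0) (fun _ => 1) (stdSimplex.vertex 0))

variable {G} {H : Type u} [Group H] [TopologicalSpace H]

/-- The map `B φ : B G → B H` induced by a continuous homomorphism `φ`. -/
def B.map (φ : G →ₜ* H) : C(B G, B H) where
  toFun := Quot.map
    (fun x => ⟨x.1, CompactCoherentification.map (fun g k => φ (g k)) x.2.1, x.2.2⟩) <| by
      rintro _ _ (⟨θ, g, t⟩ | ⟨a, g, t⟩)
      · exact BRel.simplicial θ (fun k => φ (g k)) t
      · have h := BRel.translate (φ a) (fun k => φ (g k)) t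
        simp only [← map_mul] at h
        exact h
  continuous_toFun := by
    refine continuous_coinduced_dom.2 (continuous_quot_mk.comp ?_)
    refine continuous_sigma fun n => continuous_sigmaMk.comp ?_
    have h : Continuous fun (g : Fin (n + 1) → G) k => φ (g k) :=
      continuous_pi fun k => φ.continuous_toFun.comp (continuous_apply k)
    exact ((CompactCoherentification.continuous_map_of_continuous h).comp
      continuous_fst).prodMk continuous_snd

theorem B.map_pt (φ : G →ₜ* H) : B.map φ (B.pt G) = B.pt H := by
  have h : (fun _ => φ 1 : Fin (0 + 1) → H) = fun _ => 1 := funext fun _ => map_one φ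
  exact congrArg (fun g => Quot.mk (BRel H) (PreB.mk g (stdSimplex.vertex 0))) h

end Classifying

/-! ### The maps in the short exact sequence -/

namespace OmegaSpectrum

variable (F : OmegaSpectrum.{v}) (d : ℤ)

/-- `φ^* : h^d(BG) → h^d(BG')` for a continuous homomorphism `φ : G' → G`. -/
def unreducedB {G' G : CWGrp.{u}} (φ : G' →ₜ* G) : F.Unreduced d (B G) →+ F.Unreduced d (B G') :=
  F.unreducedMap d (B.map φ)

/-- `φ^* : h̃^d(BG) → h̃^d(BG')` for a continuous homomorphism `φ : G' → G`. -/
def reducedB {G' G : CWGrp.{u}} (φ : G' →ₜ* G) :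
    F.Reduced d (B G) (B.pt G) →+ F.Reduced d (B G') (B.pt G') :=
  F.reducedMap d (B.map φ) (B.map_pt φ)

variable (G : CWGrp.{u})

/-- `i : h̃^d(BG) → h^d(BG)` forgets basepoints. -/
def iMap : F.Reduced d (B G) (B.pt G) →+ F.Unreduced d (B G) := F.forget d (B.pt G)

/-- `p : h^d(BG) → h^d(B0)` is induced by `0 ↪ G`. -/
def pMap : F.Unreduced d (B G) →+ F.Unreduced d (B CWGrp.zero.{u}) :=
  F.unreducedB d (1 : CWGrp.zero.{u} →ₜ* G)

/-- `s : h^d(B0) → h^d(BG)` is induced by `G ↠ 0`. -/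
def sMap : F.Unreduced d (B CWGrp.zero.{u}) →+ F.Unreduced d (B G) :=
  F.unreducedB d (1 : G →ₜ* CWGrp.zero.{u})

/-- `h^d(BG) → h^d(pt)`, induced by the inclusion of the basepoint `pt → BG`. -/
def restrictPt : F.Unreduced d (B G) →+ F.Unreduced d Unit :=
  F.unreducedMap d (ContinuousMap.const Unit (B.pt G))

/-- `h^d(pt) → h^d(BG)`, induced by the unique map `BG → pt`. -/
def inflatePt : F.Unreduced d Unit →+ F.Unreduced d (B G) :=
  F.unreducedMap d (ContinuousMap.const (B G) ())

end OmegaSpectrum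

end GenCoh

end

noncomputable section

namespace GenCoh

/-! ### Halos of points and cellular systems -/

/-! The algebra is formal: `B0` is a point, `0 → G → 0` is the identity, and functoriality gives the
splitting and the naturality. What needs topology is that forgetting basepoints is injective with
image the kernel of restriction to the basepoint. This holds because the basepoint of `BG` is
nondegenerate. `Halo` is Strøm's form of that condition: a deformation fixing `x₀` that has brought
`x` to `x₀` at every time later than `u x`.

Given a halo, a map whose restriction to `x₀` is null-homotopic can be dragged along the resulting
path near `x₀` until it is pointed (`Halo.exists_forgetPt_eq`). For injectivity, the structure map
replaces the target by a loop space. A free homotopy `H` between pointed maps is corrected by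
following each loop `H (t, x)` with the reverse of `H (t, x₀)`. Over `x₀` the result contracts by
backtracking, and the halo makes that contraction continuous in `x` (`Halo.forgetPt_injective`).

Halos come from `CellSystem.nonempty_halo`. If a space is built from `x₀` by attaching cells whose
boundaries are neighbourhood deformation retracts, a point flows to the boundary of its cell, then
on through lower cells, until its time is used up or it is at `x₀`. This is applied twice. The cells
of `G` give a halo at `1`, which is a vertex by the axioms of a CW-group. That halo, applied to
ratios of neighbouring entries, together with a push of the barycentric coordinates away from the
barycentre, deforms nearly degenerate simplices of `BG` to degenerate ones. Hence `BG` is a cell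
system too. Its points have nondegenerate representatives unique up to translation, since these can
be read off from a step function `[0, 1) → G`. -/

/-- A deformation `D` of `X` relative to `x₀` together with a function `u` vanishing at `x₀`, such
that every point `x` has arrived at `x₀` at all times `t > u x`. -/
structure Halo (X : Type u) [TopologicalSpace X] (x₀ : X) where
  /-- The deformation. -/
  D : C(X × I, X)
  /-- An upper bound for the time of arrival. -/
  u : C(X, ℝ)
  u_nonneg : ∀ x, 0 ≤ u x
  u_pt : u x₀ = 0
  D_zero : ∀ x, D (x, 0) = x
  D_pt : ∀ t, D (x₀, t) = x₀
  D_of_lt : ∀ x (t : I), u x < t → D (x, t) = x₀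

/-- In a space whose points are closed, one may ask for arrival at all times `t ≥ u x`. -/
theorem Halo.exists_le {X : Type u} [TopologicalSpace X] [T1Space X] {x₀ : X} (h : Halo X x₀) :
    ∃ k : Halo X x₀, ∀ x (t : I), k.u x ≤ t → k.D (x, t) = x₀ := by
  -- Doubling `u` gives strictness where `u x > 0`. Where `u x = 0`, the point is at `x₀` at all
  -- positive times, so continuity at time `0` and closedness of `{x₀}` force `x = x₀`.
  have key : ∀ x (t : I), 2 * h.u x ≤ t → h.D (x, t) = x₀ := by
    intro x t hxt
    rcases (h.u_nonneg x).eq_or_lt with h0 | h0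
    · have hx : x = x₀ := by
        have hc : Continuous fun s : I => h.D (x, s) := by fun_prop
        have hcl : IsClosed {s : I | h.D (x, s) = x₀} := isClosed_singleton.preimage hc
        have hsub : Set.Ioi (0 : I) ⊆ {s : I | h.D (x, s) = x₀} := fun s hs =>
          h.D_of_lt x s (by rw [← h0]; exact hs)
        have hmem : (0 : I) ∈ closure (Set.Ioi (0 : I)) := by
          rw [closure_Ioi' ⟨1, by simp⟩]; simp
        have := hcl.closure_subset_iff.2 hsub hmem
        rwa [Set.mem_ofPred_eq, h.D_zero] at this
      rw [hx, h.D_pt]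
    · exact h.D_of_lt x t (by linarith)
  exact ⟨{ h with
    u := ⟨fun x => 2 * h.u x, by fun_prop⟩
    u_nonneg := fun x => by simpa using h.u_nonneg x
    u_pt := by simp [h.u_pt]
    D_of_lt := fun x t hxt => key x t hxt.le }, key⟩

/-! ### Truncated times -/

/-- The truncated difference `max (t - a) 0` for `a ≥ 0`. -/
def tsub (t : I) (a : ℝ) : I := Set.projIcc 0 1 zero_le_one ((t : ℝ) - a)

/-- The truncation of a real number to `[0, 1]`. -/
def clamp (a : ℝ) : I := Set.projIcc 0 1 zero_le_one a

theorem continuous_clamp : Continuous clamp := continuous_projIcc (h := zero_le_one)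

theorem continuous_tsub : Continuous fun p : I × ℝ => tsub p.1 p.2 :=
  continuous_projIcc.comp (by fun_prop)

theorem coe_clamp {a : ℝ} (h0 : 0 ≤ a) (h1 : a ≤ 1) : (clamp a : ℝ) = a := by
  simp [clamp, Set.coe_projIcc, h0, h1]

theorem clamp_zero : clamp 0 = 0 := Set.projIcc_left zero_le_one

theorem clamp_coe (t : I) : clamp t = t := Set.projIcc_val _ _

theorem coe_tsub {t : I} {a : ℝ} (h0 : 0 ≤ a) (h1 : a ≤ t) : (tsub t a : ℝ) = t - a := by
  have := t.2.2
  simp only [tsub, Set.coe_projIcc]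
  rw [min_eq_right (by linarith), max_eq_right (by linarith)]

theorem tsub_zero (t : I) : tsub t 0 = t := by
  simp [tsub]

theorem tsub_self (t : I) : tsub t t = 0 := by
  simp [tsub]

set_option linter.checkUnivs false in
/-- A space `X` obtained from a point `x₀` by successively attaching the spaces `Q i` along closed
subspaces `A i`, each of which is a neighbourhood deformation retract: the deformation `D i` arrives
in `A i` at the time `u i`. -/
structure CellSystem (X : Type u) [TopologicalSpace X] (x₀ : X) where
  /-- The index set. -/
  ι : Type v
  /-- The dimensions. -/
  dim : ι → ℕ
  /-- The cells. -/
  Q : ι → Type w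
  [top : ∀ i, TopologicalSpace (Q i)]
  /-- The characteristic maps. -/
  q : ∀ i, C(Q i, X)
  /-- The boundaries of the cells. -/
  A : ∀ i, Set (Q i)
  /-- The times of arrival. -/
  u : ∀ i, C(Q i, ℝ)
  /-- The deformations. -/
  D : ∀ i, C(Q i × I, Q i)
  u_nonneg : ∀ i z, 0 ≤ u i z
  u_of_mem : ∀ i, ∀ z ∈ A i, u i z = 0
  D_zero : ∀ i z, D i (z, 0) = z
  D_mem : ∀ i z, u i z ≤ 1 → D i (z, clamp (u i z)) ∈ A i
  cover : ∀ x, x ≠ x₀ → ∃ i z, z ∉ A i ∧ q i z = x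
  ne_pt : ∀ i, ∀ z ∉ A i, q i z ≠ x₀
  unique : ∀ i j, ∀ z ∉ A i, ∀ w ∉ A j, q i z = q j w →
    dim i = dim j ∧ u i z = u j w ∧ ∀ t, q i (D i (z, t)) = q j (D j (w, t))
  boundary : ∀ i, ∀ a ∈ A i, q i a ≠ x₀ → ∃ j w, w ∉ A j ∧ q j w = q i a ∧ dim j < dim i
  continuous_boundary : ∀ (T : Type u) [TopologicalSpace T] (R : X → T) (i : ι),
    (∀ j, dim j < dim i → Continuous fun z => R (q j z)) → Continuous fun a : A i => R (q i a)
  continuous_of_cells : ∀ (T : Type u) [TopologicalSpace T] (R : X → T),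
    (∀ i, Continuous fun z => R (q i z)) → Continuous R

/-! ### The flow of a cell system towards the basepoint -/

namespace CellSystem

attribute [instance] CellSystem.top

variable {X : Type u} [TopologicalSpace X] {x₀ : X} (S : CellSystem.{u, v, w} X x₀)

open Classical in
/-- The dimension, plus one, of the cell whose interior contains `x`; zero for the basepoint. -/
def rank (x : X) : ℕ := if h : x ≠ x₀ then S.dim (S.cover x h).choose + 1 else 0

open Classical in
/-- The time at which `x` arrives in the boundary of its cell. -/
def time (x : X) : ℝ :=
  if h : x ≠ x₀ then S.u _ (S.cover x h).choose_spec.choose else 0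

open Classical in
/-- The trajectory of `x` in its cell. -/
def move (x : X) (t : I) : X :=
  if h : x ≠ x₀ then S.q _ (S.D _ ((S.cover x h).choose_spec.choose, t)) else x₀

theorem rank_pt : S.rank x₀ = 0 := by simp [rank]

/-- The representative chosen in `rank`, `time` and `move` need not be `(i, z)`, but the field
`unique` makes the data independent of the choice. -/
theorem interior {i : S.ι} {z : S.Q i} (hz : z ∉ S.A i) :
    S.rank (S.q i z) = S.dim i + 1 ∧ S.time (S.q i z) = S.u i z ∧
      ∀ t, S.move (S.q i z) t = S.q i (S.D i (z, t)) := by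
  have h := S.ne_pt i z hz
  obtain ⟨hw, e⟩ := (S.cover _ h).choose_spec.choose_spec
  obtain ⟨h1, h2, h3⟩ := S.unique _ _ _ hw _ hz e
  simp only [rank, time, move, dif_pos h]
  exact ⟨by rw [h1], h2, h3⟩

/-- This strict drop, from `dim i + 1` in the interior, is what makes every induction along the flow
terminate. -/
theorem rank_boundary {i : S.ι} {a : S.Q i} (ha : a ∈ S.A i) : S.rank (S.q i a) ≤ S.dim i := by
  by_cases h : S.q i a = x₀
  · simp [h, rank_pt]
  · obtain ⟨j, w, hw, e, hlt⟩ := S.boundary i a ha h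
    rw [← e, (S.interior hw).1]
    exact hlt

/-- The position and the remaining time of a point of rank at most `k`, starting at `x` with time
`t`, when it stops because it has run out of time or reached the basepoint. -/
def traj : ℕ → X → I → X × I
  | 0, x, t => (x, t)
  | k + 1, x, t =>
    if S.rank x ≤ k then traj k x t else if (t : ℝ) ≤ S.time x then (S.move x t, 0)
      else traj k (S.move x (clamp (S.time x))) (tsub t (S.time x))

/-- The position and the remaining time of a point starting at `x` with time `t`. -/
def run (x : X) (t : I) : X × I := S.traj (S.rank x) x t

/-- The counter `k` is only fuel: values above the rank of the point are skipped without moving it.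
-/
theorem traj_eq_run {k : ℕ} {x : X} (h : S.rank x ≤ k) (t : I) : S.traj k x t = S.run x t := by
  induction k with
  | zero => rw [run, Nat.le_zero.1 h]
  | succ k ih =>
    rcases h.eq_or_lt with h | h
    · rw [run, h]
    · rw [traj, if_pos (Nat.lt_succ_iff.1 h), ih (Nat.lt_succ_iff.1 h)]

theorem run_pt (t : I) : S.run x₀ t = (x₀, t) := by
  rw [run, rank_pt, traj]

theorem run_interior {i : S.ι} {z : S.Q i} (hz : z ∉ S.A i) (t : I) :
    S.run (S.q i z) t = if (t : ℝ) ≤ S.u i z then (S.q i (S.D i (z, t)), 0) else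
      S.run (S.q i (S.D i (z, clamp (S.u i z)))) (tsub t (S.u i z)) := by
  obtain ⟨h1, h2, h3⟩ := S.interior hz
  rw [run, h1, traj, if_neg (by omega), h2, h3, h3]
  split_ifs with h
  · rfl
  · exact S.traj_eq_run (S.rank_boundary (S.D_mem i z ((not_le.1 h).le.trans t.2.2))) _

theorem run_zero (x : X) : S.run x 0 = (x, 0) := by
  by_cases h : x = x₀
  · rw [h, run_pt]
  · obtain ⟨i, z, hz, rfl⟩ := S.cover x h
    rw [run_interior _ hz, if_pos (by simpa using S.u_nonneg i z), S.D_zero]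

/-- A boundary point has `u = 0`, so the second branch restarts at the same point with the same
time. The interior formula therefore holds on the whole closed cell, as needed for continuity there.
-/
theorem run_cell (i : S.ι) (z : S.Q i) (t : I) :
    S.run (S.q i z) t = if (t : ℝ) ≤ S.u i z then (S.q i (S.D i (z, t)), 0) else
      S.run (S.q i (S.D i (z, clamp (S.u i z)))) (tsub t (S.u i z)) := by
  by_cases hz : z ∈ S.A i
  · rw [S.u_of_mem i z hz, clamp_zero, S.D_zero, tsub_zero]
    split_ifs with h
    · obtain rfl : t = 0 := le_antisymm h t.2.1
      rw [S.D_zero, run_zero]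
    · rfl
  · exact S.run_interior hz t

theorem run_boundary_of_eq {i : S.ι} {z : S.Q i} {t : I} (h : (t : ℝ) = S.u i z) :
    S.run (S.q i (S.D i (z, clamp (S.u i z)))) (tsub t (S.u i z)) =
      (S.q i (S.D i (z, t)), 0) := by
  rw [← h, clamp_coe, tsub_self, run_zero]

theorem continuous_run (x : X) : Continuous (S.run x) := by
  induction hn : S.rank x using Nat.strong_induction_on generalizing x with
  | _ n ih =>
    by_cases h : x = x₀
    · subst h
      exact (Continuous.prodMk_right x).congr fun t => (S.run_pt t).symm
    · obtain ⟨i, z, hz, rfl⟩ := S.cover x h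
      refine Continuous.congr ?_ fun t => (S.run_interior hz t).symm
      refine continuous_if_le (by fun_prop) (by fun_prop) (Continuous.continuousOn (by fun_prop)) ?_
        fun t ht => (S.run_boundary_of_eq ht).symm
      by_cases hu : S.u i z ≤ 1
      · refine Continuous.continuousOn ((ih _ ?_ _ rfl).comp
          (continuous_tsub.comp (continuous_id.prodMk continuous_const)))
        rw [← hn, (S.interior hz).1, Nat.lt_succ_iff]
        exact S.rank_boundary (S.D_mem i z hu)
      -- The arrival time exceeds `1`, so the second branch is never entered.
      · exact fun t (ht : S.u i z ≤ t) => absurd (ht.trans t.2.2) hu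

/-- Currying the time turns the flow into a map out of `X` alone, to which the gluing properties of
the cell system apply; evaluation at times recovers joint continuity. By induction on dimension the
flow is continuous on the boundary, and the second branch factors through the arrival point there.
-/
theorem continuous_run_cell (i : S.ι) :
    Continuous fun z => (⟨S.run (S.q i z), S.continuous_run _⟩ : C(I, X × I)) := by
  induction hn : S.dim i using Nat.strong_induction_on generalizing i with
  | _ n ih =>
    have hA := S.continuous_boundary C(I, X × I) (fun x => ⟨S.run x, S.continuous_run x⟩) i
      fun j hj => ih _ (hn ▸ hj) j rfl
    refine ContinuousMap.continuous_of_continuous_uncurry _ ?_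
    refine Continuous.congr ?_ fun p => (S.run_cell i p.1 p.2).symm
    refine continuous_if_le (by fun_prop) (by fun_prop) (Continuous.continuousOn
      (((S.q i).continuous.comp (S.D i).continuous).prodMk continuous_const)) ?_
      fun p hp => (S.run_boundary_of_eq hp).symm
    rw [continuousOn_iff_continuous_domRestrict]
    have hmem : ∀ p : {p : S.Q i × I | S.u i p.1 ≤ p.2},
        S.D i (p.1.1, clamp (S.u i p.1.1)) ∈ S.A i := fun p =>
      S.D_mem i _ (p.2.trans p.1.2.2.2)
    have hg : Continuous fun p : {p : S.Q i × I | S.u i p.1 ≤ p.2} =>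
        (⟨S.D i (p.1.1, clamp (S.u i p.1.1)), hmem p⟩ : S.A i) := by
      refine Continuous.subtype_mk ?_ _
      exact (S.D i).continuous.comp ((continuous_fst.comp continuous_subtype_val).prodMk
        (continuous_clamp.comp ((S.u i).continuous.comp
          (continuous_fst.comp continuous_subtype_val))))
    exact (continuous_eval (F := C(I, X × I))).comp ((hA.comp hg).prodMk
      (continuous_tsub.comp ((continuous_snd.comp continuous_subtype_val).prodMk
        ((S.u i).continuous.comp (continuous_fst.comp continuous_subtype_val)))))

theorem run_snd_le (x : X) (t : I) : (S.run x t).2 ≤ t := by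
  induction hn : S.rank x using Nat.strong_induction_on generalizing x t with
  | _ n ih =>
    by_cases h : x = x₀
    · rw [h, run_pt]
    · obtain ⟨i, z, hz, rfl⟩ := S.cover x h
      rw [run_interior _ hz]
      split_ifs with ht
      · exact t.2.1
      · push Not at ht
        have hlt : S.rank (S.q i (S.D i (z, clamp (S.u i z)))) < n := by
          rw [← hn, (S.interior hz).1, Nat.lt_succ_iff]
          exact S.rank_boundary (S.D_mem i z (ht.le.trans t.2.2))
        refine (ih _ hlt _ _ rfl).trans ?_
        have := coe_tsub (S.u_nonneg i z) ht.le
        exact Subtype.coe_le_coe.1 (by rw [this]; linarith [S.u_nonneg i z])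

/-- Starting with time `a`, the basepoint is reached after `a` minus the remaining time. If that is
less than `b`, a budget of `b` already suffices. -/
theorem run_fst_of_lt (x : X) (a b : I) (hab : b ≤ a) (h : (a : ℝ) - b < (S.run x a).2) :
    (S.run x b).1 = x₀ := by
  induction hn : S.rank x using Nat.strong_induction_on generalizing x a b with
  | _ n ih =>
    replace hab : (b : ℝ) ≤ a := hab
    by_cases hx : x = x₀
    · rw [hx, run_pt]
    · obtain ⟨i, z, hz, rfl⟩ := S.cover x hx
      rw [run_interior _ hz] at h ⊢
      by_cases ha : (a : ℝ) ≤ S.u i z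
      · rw [if_pos ha] at h
        simp only [Set.Icc.coe_zero] at h
        linarith
      · rw [if_neg ha] at h
        push Not at ha
        have h1 := coe_tsub (S.u_nonneg i z) ha.le
        have hle : ((S.run (S.q i (S.D i (z, clamp (S.u i z)))) (tsub a (S.u i z))).2 : ℝ) ≤
            tsub a (S.u i z) := S.run_snd_le _ _
        have hb : S.u i z < b := by linarith
        have h2 := coe_tsub (S.u_nonneg i z) hb.le
        rw [if_neg hb.not_ge]
        refine ih _ ?_ _ (tsub a (S.u i z)) _ ?_ ?_ rfl
        · rw [← hn, (S.interior hz).1, Nat.lt_succ_iff]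
          exact S.rank_boundary (S.D_mem i z (ha.le.trans a.2.2))
        · exact Subtype.coe_le_coe.1 (by linarith)
        · linarith

/-- The basepoint of a cell system has a halo. -/
theorem nonempty_halo (S : CellSystem.{u, v, w} X x₀) : Nonempty (Halo X x₀) := by
  have hc : Continuous fun x => (⟨S.run x, S.continuous_run x⟩ : C(I, X × I)) :=
    S.continuous_of_cells _ _ S.continuous_run_cell
  have hc' : Continuous fun p : X × I => S.run p.1 p.2 :=
    (continuous_eval (F := C(I, X × I))).comp (hc.prodMap continuous_id)
  exact ⟨{
    D := ⟨fun p => (S.run p.1 p.2).1, continuous_fst.comp hc'⟩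
    -- The time of arrival at `x₀`, or `1` if the unit budget runs out with no time remaining.
    u := ⟨fun x => 1 - ((S.run x 1).2 : ℝ), by fun_prop⟩
    u_nonneg := fun x => sub_nonneg.2 (S.run x 1).2.2.2
    u_pt := by simp [run_pt]
    D_zero := fun x => by simp [run_zero]
    D_pt := fun t => by simp [run_pt]
    D_of_lt := fun x t h => S.run_fst_of_lt x 1 t t.2.2 (by
      simp only [ContinuousMap.coe_mk] at h
      simp only [Set.Icc.coe_one]; linarith) }⟩

end CellSystem

/-! ### CW complexes -/

section CW

variable {X : Type u} [TopologicalSpace X]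

/-- A map from a compact space to a Hausdorff space is closed, hence a quotient map onto its image.
-/
theorem continuousOn_range_of_comp {K : Type w} [TopologicalSpace K] [CompactSpace K] [T2Space X]
    {T : Type v} [TopologicalSpace T] (f : C(K, X)) (R : X → T) (h : Continuous fun z => R (f z)) :
    ContinuousOn R (Set.range f) := by
  rw [continuousOn_iff_continuous_domRestrict]
  have hf : Continuous (Set.rangeFactorization f) := f.continuous.subtype_mk _
  exact (hf.isClosedMap.isQuotientMap hf Set.rangeFactorization_surjective).continuous_iff.2 h

/-- The deformation of the unit ball minus its centre away from the centre. -/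
def ballPush (n : ℕ) : C(Metric.closedBall (0 : Fin n → ℝ) 1 × I,
    Metric.closedBall (0 : Fin n → ℝ) 1) where
  toFun p := ⟨((1 + (p.2 : ℝ)) / max 1 ((1 + p.2) * ‖p.1.1‖)) • p.1.1, by
    have h0 := p.2.2.1
    have h1 : 0 < max 1 ((1 + (p.2 : ℝ)) * ‖p.1.1‖) := lt_max_of_lt_left one_pos
    rw [mem_closedBall_zero_iff, norm_smul, Real.norm_of_nonneg (by positivity), div_mul_eq_mul_div,
      div_le_one h1]
    exact le_max_right _ _⟩
  continuous_toFun := by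
    have h1 : Continuous fun p : Metric.closedBall (0 : Fin n → ℝ) 1 × I => (1 + (p.2 : ℝ)) := by
      fun_prop
    have h2 : Continuous fun p : Metric.closedBall (0 : Fin n → ℝ) 1 × I =>
      max 1 ((1 + (p.2 : ℝ)) * ‖p.1.1‖) := by fun_prop
    exact ((h1.div h2 fun p => (lt_max_of_lt_left one_pos).ne').smul
      (continuous_subtype_val.comp continuous_fst)).subtype_mk _

theorem ballPush_zero {n : ℕ} (z : Metric.closedBall (0 : Fin n → ℝ) 1) :
    ballPush n (z, 0) = z := by
  have := mem_closedBall_zero_iff.1 z.2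
  ext1
  simp [ballPush, this]

theorem norm_ballPush {n : ℕ} (z : Metric.closedBall (0 : Fin n → ℝ) 1) (t : I)
    (h : 2 * (1 - ‖z.1‖) = t) : ‖(ballPush n (z, t)).1‖ = 1 := by
  have hz := mem_closedBall_zero_iff.1 z.2
  have h0 := t.2.1
  have h1 := t.2.2
  -- With `r = ‖z‖` and `t = 2 (1 - r)`, one has `(1 + t) r - 1 = (2 r - 1) (1 - r)`, and `t ≤ 1`
  -- gives `r ≥ 1 / 2`.
  have key : 1 ≤ (1 + (t : ℝ)) * ‖z.1‖ := by rw [← h]; nlinarith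
  simp only [ballPush, ContinuousMap.coe_mk]
  rw [max_eq_right key, norm_smul, Real.norm_of_nonneg (by positivity), div_mul_eq_mul_div,
    div_self (by linarith)]

variable [CWComplex (Set.univ : Set X)]

open RelCWComplex in
/-- The characteristic map of a cell, restricted to the closed ball. -/
def cellMap (n : ℕ) (i : cell (Set.univ : Set X) n) :
    C(Metric.closedBall (0 : Fin n → ℝ) 1, X) :=
  ⟨fun z => map n i z.1, (RelCWComplex.continuousOn n i).domRestrict⟩

open RelCWComplex

theorem range_cellMap (n : ℕ) (i : cell (Set.univ : Set X) n) :
    Set.range (cellMap n i) = closedCell n i := by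
  ext x
  exact ⟨fun ⟨z, h⟩ => ⟨z.1, z.2, h⟩, fun ⟨z, hz, h⟩ => ⟨⟨z, hz⟩, h⟩⟩

theorem mem_ball_of_norm_ne {n : ℕ} {z : Metric.closedBall (0 : Fin n → ℝ) 1} (h : ‖z.1‖ ≠ 1) :
    z.1 ∈ Metric.ball 0 1 :=
  mem_ball_zero_iff.2 ((mem_closedBall_zero_iff.1 z.2).lt_of_ne h)

theorem cellMap_mem_openCell {n : ℕ} (i : cell (Set.univ : Set X) n)
    {z : Metric.closedBall (0 : Fin n → ℝ) 1} (h : ‖z.1‖ ≠ 1) : cellMap n i z ∈ openCell n i :=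
  ⟨z.1, mem_ball_of_norm_ne h, rfl⟩

/-- A nonempty CW complex has a vertex. -/
theorem nonempty_cell_zero (n : ℕ) (i : cell (Set.univ : Set X) n) :
    Nonempty (cell (Set.univ : Set X) 0) := by
  induction n using Nat.strong_induction_on with
  | _ n ih =>
    rcases Nat.eq_zero_or_pos n with rfl | hn
    · exact ⟨i⟩
    · obtain ⟨x, hx⟩ := nonempty_cellFrontier hn.ne' i
      obtain ⟨J, hJ⟩ := CWComplex.cellFrontier_subset_finite_closedCell n i
      have h2 := hJ hx
      simp only [Set.mem_iUnion] at h2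
      obtain ⟨m, hm, j, -⟩ := h2
      exact ih m hm j

variable [T2Space X]

/-- The cells of a CW complex other than a given vertex. -/
def cwCellSystem (x₀ : X) (j₀ : cell (Set.univ : Set X) 0) (h₀ : openCell 0 j₀ = {x₀}) :
    CellSystem.{u, u, 0} X x₀ where
  ι := {p : Σ n, cell (Set.univ : Set X) n // p ≠ ⟨0, j₀⟩}
  dim p := p.1.1
  Q p := Metric.closedBall (0 : Fin p.1.1 → ℝ) 1
  q p := cellMap p.1.1 p.1.2
  -- For a 0-cell this set is empty and the time of arrival is `2`, so vertices other than `x₀`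
  -- never move.
  A p := {z | ‖z.1‖ = 1}
  u p := ⟨fun z => 2 * (1 - ‖z.1‖), by fun_prop⟩
  D p := ballPush p.1.1
  u_nonneg p z := by
    have := mem_closedBall_zero_iff.1 z.2
    simp only [ContinuousMap.coe_mk]
    linarith
  u_of_mem p z hz := by
    replace hz : ‖z.1‖ = 1 := hz
    simp [hz]
  D_zero p z := ballPush_zero z
  D_mem p z hz := by
    have := mem_closedBall_zero_iff.1 z.2
    exact norm_ballPush z _ (coe_clamp (by simp only [ContinuousMap.coe_mk]; linarith) hz).symm
  cover x hx := by
    have : x ∈ ⋃ (n : ℕ) (j : cell (Set.univ : Set X) n), openCell n j := by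
      rw [CWComplex.iUnion_openCell_eq_complex]; trivial
    simp only [Set.mem_iUnion] at this
    obtain ⟨n, j, z, hz, rfl⟩ := this
    refine ⟨⟨⟨n, j⟩, ?_⟩, ⟨z, Metric.ball_subset_closedBall hz⟩, (mem_ball_zero_iff.1 hz).ne, rfl⟩
    rintro h
    have h1 : map n j z ∈ openCell n j := ⟨z, hz, rfl⟩
    cases h
    rw [h₀] at h1
    exact hx h1
  ne_pt p z hz h := by
    apply p.2
    have h1 := cellMap_mem_openCell p.1.2 hz
    refine CWComplex.eq_of_not_disjoint_openCell (Set.not_disjoint_iff.2 ⟨_, h1, ?_⟩)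
    rw [h₀]
    exact h
  unique := by
    rintro ⟨⟨n, i⟩, hi⟩ ⟨⟨m, j⟩, hj⟩ z hz w hw h
    have h1 := cellMap_mem_openCell i hz
    have h2 := cellMap_mem_openCell j hw
    have e := CWComplex.eq_of_not_disjoint_openCell (Set.not_disjoint_iff.2 ⟨_, h1, h ▸ h2⟩)
    cases e
    have : z = w := by
      refine Subtype.ext ((map n i).injOn ?_ ?_ h) <;> rw [RelCWComplex.source_eq]
      · exact mem_ball_of_norm_ne hz
      · exact mem_ball_of_norm_ne hw
    subst this
    exact ⟨rfl, rfl, fun _ => rfl⟩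
  boundary := by
    rintro ⟨⟨n, i⟩, hi⟩ a ha hx
    have h1 : cellMap n i a ∈ cellFrontier n i := ⟨a.1, mem_sphere_zero_iff_norm.2 ha, rfl⟩
    obtain ⟨J, hJ⟩ := CWComplex.cellFrontier_subset_finite_openCell n i
    have h2 := hJ h1
    simp only [Set.mem_iUnion] at h2
    obtain ⟨m, hm, j, hj, z, hz, e⟩ := h2
    refine ⟨⟨⟨m, j⟩, ?_⟩, ⟨z, Metric.ball_subset_closedBall hz⟩, (mem_ball_zero_iff.1 hz).ne, e, hm⟩
    rintro h
    have h1 : map m j z ∈ openCell m j := ⟨z, hz, rfl⟩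
    cases h
    rw [h₀] at h1
    exact hx (e ▸ h1)
  continuous_boundary T _ R := by
    rintro ⟨⟨n, i⟩, hi⟩ hR
    have hcell : ∀ m < n, ∀ j : cell (Set.univ : Set X) m, ContinuousOn R (closedCell m j) := by
      intro m hm j
      by_cases h : (⟨m, j⟩ : Σ n, cell (Set.univ : Set X) n) = ⟨0, j₀⟩
      · cases h
        rw [closedCell_zero_eq_singleton]
        exact continuousOn_singleton _ _
      · rw [← range_cellMap]
        exact continuousOn_range_of_comp _ _ (hR ⟨⟨m, j⟩, h⟩ hm)
    obtain ⟨J, hJ⟩ := CWComplex.cellFrontier_subset_finite_closedCell n i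
    have hU : ContinuousOn R (⋃ (m : Fin n) (j : J m), closedCell m.1 j.1) := by
      refine (locallyFinite_of_finite _).continuousOn_iUnion (fun m => ?_) fun m => ?_
      · exact isClosed_iUnion_of_finite fun j => isClosed_closedCell
      · exact (locallyFinite_of_finite _).continuousOn_iUnion (fun j => isClosed_closedCell)
          fun j => hcell m.1 m.2 j.1
    refine hU.comp_continuous ((cellMap n i).continuous.comp continuous_subtype_val) fun a => ?_
    have h1 : cellMap n i a.1 ∈ cellFrontier n i := ⟨a.1.1, mem_sphere_zero_iff_norm.2 a.2, rfl⟩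
    have h2 := hJ h1
    simp only [Set.mem_iUnion] at h2 ⊢
    obtain ⟨m, hm, j, hj, h3⟩ := h2
    exact ⟨⟨m, hm⟩, ⟨j, hj⟩, h3⟩
  continuous_of_cells T _ R hR := by
    have hcell : ∀ n, ∀ j : cell (Set.univ : Set X) n, ContinuousOn R (closedCell n j) := by
      intro m j
      by_cases h : (⟨m, j⟩ : Σ n, cell (Set.univ : Set X) n) = ⟨0, j₀⟩
      · cases h
        rw [closedCell_zero_eq_singleton]
        exact continuousOn_singleton _ _
      · rw [← range_cellMap]
        exact continuousOn_range_of_comp _ _ (hR ⟨⟨m, j⟩, h⟩)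
    refine continuous_iff_isClosed.2 fun s hs => ?_
    rw [CWComplex.closed Set.univ _ (Set.subset_univ _)]
    intro n j
    rw [Set.inter_comm]
    exact (hcell n j).preimage_isClosed_of_isClosed isClosed_closedCell hs

end CW

/-! ### The halo at the neutral element of a CW-group -/

open RelCWComplex in
/-- The neutral element of a CW-group is a vertex. -/
theorem CWGrp.exists_one_cell (G : CWGrp.{u}) :
    ∃ j : cell (Set.univ : Set G) 0, openCell 0 j = {1} := by
  have h1 : (1 : G) ∈ ⋃ (n : ℕ) (j : cell (Set.univ : Set G) n), openCell n j := by
    rw [CWComplex.iUnion_openCell_eq_complex]; trivial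
  simp only [Set.mem_iUnion] at h1
  obtain ⟨n, j, -⟩ := h1
  obtain ⟨i⟩ := nonempty_cell_zero n j
  obtain ⟨g, hg⟩ := RelCWComplex.openCell_nonempty 0 i
  obtain ⟨i', hi'⟩ := G.inv_cell 0 i
  -- For any vertex `g`, also `g⁻¹` is a vertex, so `1 = g * g⁻¹` lies in a cell of dimension at
  -- most `0 + 0`.
  obtain ⟨m, hm, k, hk⟩ := G.mul_cell 0 0 i i' g hg g⁻¹ (hi' ▸ ⟨g, hg, rfl⟩)
  obtain rfl : m = 0 := by omega
  refine ⟨k, ?_⟩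
  rw [mul_inv_cancel] at hk
  rw [RelCWComplex.openCell_zero_eq_singleton] at hk ⊢
  rw [Set.mem_singleton_iff.1 hk]

/-- The neutral element of a CW-group has a halo. -/
theorem CWGrp.nonempty_halo (G : CWGrp.{u}) :
    ∃ k : Halo G 1, ∀ x (t : I), k.u x ≤ t → k.D (x, t) = 1 := by
  obtain ⟨j, hj⟩ := G.exists_one_cell
  exact (cwCellSystem 1 j hj).nonempty_halo.some.exists_le

/-! ### Nondegenerate representatives of points of the classifying space -/

section StepFunction

/-- The sum of the barycentric coordinates before the `j`-th. -/
def partialSum {n : ℕ} (t : stdSimplex ℝ (Fin (n + 1))) (j : ℕ) : ℝ :=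
  ∑ i with i.val < j, t i

variable {n m : ℕ} (t : stdSimplex ℝ (Fin (n + 1)))

theorem partialSum_zero : partialSum t 0 = 0 := by simp [partialSum]

theorem partialSum_of_le {j : ℕ} (h : n + 1 ≤ j) : partialSum t j = 1 := by
  rw [partialSum, Finset.filter_true_of_mem fun i _ => i.2.trans_le h, stdSimplex.sum_eq_one]

theorem partialSum_succ (j : Fin (n + 1)) :
    partialSum t (j + 1) = partialSum t j + t j := by
  have : (Finset.univ.filter fun i : Fin (n + 1) => i.val < j + 1) =
      insert j (Finset.univ.filter fun i : Fin (n + 1) => i.val < j) := by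
    ext i
    simp only [Finset.mem_filter, Finset.mem_univ, true_and, Finset.mem_insert, Fin.ext_iff]
    omega
  rw [partialSum, this, Finset.sum_insert (by simp), add_comm, partialSum]

theorem partialSum_mono : Monotone (partialSum t) := fun i j h =>
  Finset.sum_le_sum_of_subset_of_nonneg
    (fun k hk => by simp only [Finset.mem_filter] at hk ⊢; exact ⟨hk.1, hk.2.trans_le h⟩)
    fun k _ _ => stdSimplex.zero_le t k

theorem exists_partialSum {y : ℝ} (h0 : 0 ≤ y) (h1 : y < 1) :
    ∃ j : Fin (n + 1), partialSum t j ≤ y ∧ y < partialSum t (j + 1) := by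
  have h : ∃ j, y < partialSum t j := ⟨n + 1, by rwa [partialSum_of_le t le_rfl]⟩
  classical
  have hpos : Nat.find h ≠ 0 := fun e => by
    have := Nat.find_spec h
    rw [e, partialSum_zero] at this
    linarith
  obtain ⟨k, hk⟩ := Nat.exists_eq_succ_of_ne_zero hpos
  have hkt : k < Nat.find h := by omega
  have hle : Nat.find h ≤ n + 1 := Nat.find_min' h (by rwa [partialSum_of_le t le_rfl])
  refine ⟨⟨k, hkt.trans_le hle⟩, not_lt.1 (Nat.find_min h hkt), ?_⟩
  have := Nat.find_spec h
  rwa [hk] at this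

theorem partialSum_unique {y : ℝ} {i j : Fin (n + 1)} (hi : partialSum t i ≤ y)
    (hi' : y < partialSum t (i + 1)) (hj : partialSum t j ≤ y) (hj' : y < partialSum t (j + 1)) :
    i = j := by
  rcases lt_trichotomy i j with h | h | h
  · have := partialSum_mono t (Nat.succ_le_of_lt (Fin.lt_def.1 h))
    simp only [Nat.succ_eq_add_one] at this
    linarith
  · exact h
  · have := partialSum_mono t (Nat.succ_le_of_lt (Fin.lt_def.1 h))
    simp only [Nat.succ_eq_add_one] at this
    linarith

open Classical in
/-- The index `j` such that `y` lies in the `j`-th of the consecutive half-open intervals of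
lengths `t 0, …, t n`. -/
def stepIndex (y : ℝ) : Fin (n + 1) :=
  if h : ∃ j : Fin (n + 1), partialSum t j ≤ y ∧ y < partialSum t (j + 1) then h.choose else 0

theorem stepIndex_spec {y : ℝ} (h0 : 0 ≤ y) (h1 : y < 1) :
    partialSum t (stepIndex t y) ≤ y ∧ y < partialSum t (stepIndex t y + 1) := by
  have h := exists_partialSum t h0 h1
  rw [stepIndex, dif_pos h]
  exact h.choose_spec

theorem stepIndex_eq {y : ℝ} {j : Fin (n + 1)} (h0 : partialSum t j ≤ y)
    (h1 : y < partialSum t (j + 1)) : stepIndex t y = j := by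
  have h : ∃ j : Fin (n + 1), partialSum t j ≤ y ∧ y < partialSum t (j + 1) := ⟨j, h0, h1⟩
  rw [stepIndex, dif_pos h]
  exact partialSum_unique t h.choose_spec.1 h.choose_spec.2 h0 h1

theorem partialSum_map (θ : Fin (n + 1) → Fin (m + 1)) (j : ℕ) :
    partialSum (stdSimplex.map θ t) j = ∑ i with (θ i).val < j, t i := by
  simp only [partialSum, stdSimplex.map_coe, FunOnFinite.linearMap_apply_apply]
  rw [← Finset.sum_fiberwise_of_maps_to (s := Finset.univ.filter fun i => (θ i).val < j)
    (t := Finset.univ.filter fun i : Fin (m + 1) => i.val < j) (g := θ) (by simp)]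
  refine Finset.sum_congr rfl fun k hk => Finset.sum_congr ?_ fun _ _ => rfl
  ext i
  simp only [Finset.mem_filter, Finset.mem_univ, true_and] at hk ⊢
  constructor
  · rintro rfl; exact ⟨hk, rfl⟩
  · exact fun h => h.2

/-- As `θ` is monotone, the `j`-th interval of `θ_* t` is the union of the consecutive intervals of
`t` with indices in the fibre over `j`. -/
theorem stepIndex_map (θ : Fin (n + 1) →o Fin (m + 1)) {y : ℝ} (h0 : 0 ≤ y) (h1 : y < 1) :
    stepIndex (stdSimplex.map θ t) y = θ (stepIndex t y) := by
  obtain ⟨h2, h3⟩ := stepIndex_spec t h0 h1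
  apply stepIndex_eq
  · rw [partialSum_map]
    refine le_trans (Finset.sum_le_sum_of_subset_of_nonneg (fun i hi => ?_)
      fun i _ _ => stdSimplex.zero_le t i) h2
    simp only [Finset.mem_filter, Finset.mem_univ, true_and] at hi ⊢
    by_contra hc
    exact absurd (θ.monotone (Fin.le_def.2 (not_lt.1 hc))) (not_le.2 (Fin.lt_def.2 hi))
  · rw [partialSum_map]
    refine h3.trans_le (Finset.sum_le_sum_of_subset_of_nonneg (fun i hi => ?_)
      fun i _ _ => stdSimplex.zero_le t i)
    simp only [Finset.mem_filter, Finset.mem_univ, true_and] at hi ⊢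
    exact Nat.lt_succ_of_le (Fin.le_def.1 (θ.monotone (Fin.le_def.2 (Nat.lt_succ_iff.1 hi))))

theorem pos_of_ne {n : ℕ} {t : stdSimplex ℝ (Fin (n + 1))} (h : ∀ i, t i ≠ 0)
    (i : Fin (n + 1)) : 0 < t i := (stdSimplex.zero_le t i).lt_of_ne (h i).symm

end StepFunction

/-! ### Step functions and uniqueness of nondegenerate representatives -/

section Representatives

variable {G : Type u} [TopologicalSpace G]

variable (G) in
/-- The space `G^(n+1) × Δ^n`. -/
abbrev GSimplex (n : ℕ) : Type u :=
  CompactCoherentification (Fin (n + 1) → G) × stdSimplex ℝ (Fin (n + 1))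

/-- The entries of the first component of a point of `G^(n+1) × Δ^n`. -/
def GSimplex.entry {n : ℕ} (z : GSimplex G n) : Fin (n + 1) → G :=
  (CompactCoherentification.mk _).symm z.1

theorem GSimplex.continuous_entry {n : ℕ} (i : Fin (n + 1)) :
    Continuous fun z : GSimplex G n => z.entry i :=
  ((continuous_apply i).comp CompactCoherentification.continuous_mk_symm).comp continuous_fst

theorem GSimplex.continuous_coord {n : ℕ} (i : Fin (n + 1)) :
    Continuous fun z : GSimplex G n => z.2 i :=
  ((continuous_apply i).comp continuous_subtype_val).comp continuous_snd

/-- The step function `[0, 1) → G` with values `g i` on intervals of lengths `t i`. -/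
def PreB.step (x : PreB G) (y : ℝ) : G :=
  GSimplex.entry x.2 (stepIndex x.2.2 y)

/-- A representative with nonzero barycentric coordinates and distinct neighbouring entries. -/
def Nondeg {n : ℕ} (z : GSimplex G n) :
    Prop :=
  (∀ i, z.2 i ≠ 0) ∧ ∀ i j : Fin (n + 1), j.val = i.val + 1 →
    z.entry i ≠ z.entry j

theorem Nondeg.step {n : ℕ} {z : GSimplex G n}
    (y : ℝ) (j : Fin (n + 1)) (h0 : partialSum z.2 j ≤ y)
    (h1 : y < partialSum z.2 (j + 1)) :
    PreB.step ⟨n, z⟩ y = z.entry j := by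
  rw [PreB.step, stepIndex_eq z.2 h0 h1]

/-- Omitting the `i`-th entry and adding up barycentric coordinates along `predAbove p`. -/
def reduce {n : ℕ} (i : Fin (n + 2)) (p : Fin (n + 1))
    (z : GSimplex G (n + 1)) :
    GSimplex G n :=
  (CompactCoherentification.map (fun g k => g (i.succAbove k)) z.1, stdSimplex.map p.predAbove z.2)

theorem continuous_reduce {n : ℕ} (i : Fin (n + 2)) (p : Fin (n + 1)) :
    Continuous (reduce (G := G) i p) := by
  have h : Continuous fun (g : Fin (n + 2) → G) (k : Fin (n + 1)) => g (i.succAbove k) := by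
    fun_prop
  exact ((CompactCoherentification.continuous_map_of_continuous h).comp continuous_fst).prodMk
    ((stdSimplex.continuous_map _).comp continuous_snd)

variable [Group G]

/-- The step function up to left translation is an invariant of points of `BG`: simplicial
identifications only subdivide or merge intervals of constancy, and translations multiply all
values. -/
theorem PreB.step_of_quot_eq {x x' : PreB G} (h : Quot.mk (BRel G) x = Quot.mk (BRel G) x') :
    ∃ a : G, ∀ y : ℝ, 0 ≤ y → y < 1 → x'.step y = a * x.step y := by
  replace h := Quot.eqvGen_exact h
  induction h with
  | rel x x' h =>
    rcases h with ⟨θ, g, t⟩ | ⟨a, g, t⟩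
    · refine ⟨1, fun y h0 h1 => ?_⟩
      rw [one_mul, PreB.step, PreB.step]
      exact congrArg g (stepIndex_map t θ h0 h1)
    · exact ⟨a, fun y _ _ => rfl⟩
  | refl x => exact ⟨1, fun y _ _ => (one_mul _).symm⟩
  | symm x x' _ ih =>
    obtain ⟨a, ha⟩ := ih
    exact ⟨a⁻¹, fun y h0 h1 => by rw [ha y h0 h1, inv_mul_cancel_left]⟩
  | trans x x' x'' _ _ ih ih' =>
    obtain ⟨a, ha⟩ := ih
    obtain ⟨b, hb⟩ := ih'
    exact ⟨b * a, fun y h0 h1 => by rw [hb y h0 h1, ha y h0 h1, mul_assoc]⟩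

/-- The point of `B G` given by a point of `G^(n+1) × Δ^n`. -/
def B.mk (n : ℕ) :
    C(GSimplex G n, B G) :=
  ⟨fun z => Quot.mk _ ⟨n, z⟩, continuous_quot_mk.comp continuous_sigmaMk⟩

/-- If the step functions of two nondegenerate representatives agree up to a translation and the
first has its `(j+1)`-st jump before the second, there is a contradiction. -/
theorem Nondeg.not_partialSum_lt {n m : ℕ} {z : GSimplex G n} {w : GSimplex G m}
    (hz : Nondeg z) {a : G}
    (h : ∀ y : ℝ, 0 ≤ y → y < 1 → PreB.step ⟨m, w⟩ y = a * PreB.step ⟨n, z⟩ y)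
    (j : ℕ) (hj : j < n + 1) (hj' : j < m + 1) (hp : partialSum z.2 j = partialSum w.2 j) :
    ¬ partialSum z.2 (j + 1) < partialSum w.2 (j + 1) := by
  intro hlt
  have hw1 : partialSum w.2 (j + 1) ≤ 1 :=
    (partialSum_mono w.2 (show j + 1 ≤ m + 1 by omega)).trans_eq (partialSum_of_le _ le_rfl)
  have hn : j + 1 < n + 1 := by
    by_contra hc
    rw [partialSum_of_le z.2 (by omega)] at hlt
    linarith
  have hs := partialSum_succ z.2 ⟨j, hj⟩
  have hs' := partialSum_succ z.2 ⟨j + 1, hn⟩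
  have p1 := pos_of_ne hz.1 ⟨j, hj⟩
  have p2 := pos_of_ne hz.1 ⟨j + 1, hn⟩
  have h0 : 0 ≤ partialSum z.2 j := by
    rw [← partialSum_zero z.2]; exact partialSum_mono z.2 (Nat.zero_le j)
  simp only at hs hs'
  -- The function of `z` is sampled on both sides of its jump at `partialSum z.2 (j + 1)`. Both
  -- sample points lie in the `j`-th interval of `w`, so the neighbouring entries of `z` would
  -- agree.
  have e1 := Nondeg.step (z := z) (partialSum z.2 j) ⟨j, hj⟩ le_rfl (by simp only; linarith)
  have e2 := Nondeg.step (z := z) (partialSum z.2 (j + 1)) ⟨j + 1, hn⟩ le_rfl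
    (by simp only; linarith)
  have e3 := Nondeg.step (z := w) (partialSum z.2 j) ⟨j, hj'⟩ hp.ge (by simp only; linarith)
  have e4 := Nondeg.step (z := w) (partialSum z.2 (j + 1)) ⟨j, hj'⟩ (by simp only; linarith) hlt
  rw [h _ h0 (by linarith), e1] at e3
  rw [h _ (by linarith) (by linarith), e2, ← e3] at e4
  exact hz.2 ⟨j, hj⟩ ⟨j + 1, hn⟩ rfl (mul_left_cancel e4).symm

theorem Nondeg.partialSum_eq {n m : ℕ} {z : GSimplex G n} {w : GSimplex G m}
    (hz : Nondeg z) (hw : Nondeg w) {a : G}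
    (h : ∀ y : ℝ, 0 ≤ y → y < 1 → PreB.step ⟨m, w⟩ y = a * PreB.step ⟨n, z⟩ y)
    (j : ℕ) (hj : j ≤ n + 1) (hj' : j ≤ m + 1) : partialSum z.2 j = partialSum w.2 j := by
  induction j with
  | zero => rw [partialSum_zero, partialSum_zero]
  | succ j ih =>
    have hp := ih (by omega) (by omega)
    refine le_antisymm (not_lt.1 (hw.not_partialSum_lt (a := a⁻¹) (fun y h0 h1 => ?_) j (by omega) (by omega)
      hp.symm)) (not_lt.1 (hz.not_partialSum_lt h j (by omega) (by omega) hp))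
    rw [h y h0 h1, inv_mul_cancel_left]

/-- If `n > m`, the first `m + 1` coordinates of `z` already sum to `1`, leaving no room for the
next, positive one. -/
theorem Nondeg.dim_le {n m : ℕ} {z : GSimplex G n} {w : GSimplex G m}
    (hz : Nondeg z) (hw : Nondeg w) {a : G}
    (h : ∀ y : ℝ, 0 ≤ y → y < 1 → PreB.step ⟨m, w⟩ y = a * PreB.step ⟨n, z⟩ y) : n ≤ m := by
  by_contra hc
  have e := hz.partialSum_eq hw h (m + 1) (by omega) le_rfl
  rw [partialSum_of_le w.2 le_rfl] at e
  have hs := partialSum_succ z.2 ⟨m + 1, by omega⟩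
  have := pos_of_ne hz.1 ⟨m + 1, by omega⟩
  have := (partialSum_mono z.2 (show m + 1 + 1 ≤ n + 1 by omega)).trans_eq
    (partialSum_of_le _ le_rfl)
  simp only at hs
  linarith

/-- Nondegenerate representatives are unique up to translation. -/
theorem Nondeg.unique {n m : ℕ} {z : GSimplex G n} {w : GSimplex G m}
    (hz : Nondeg z) (hw : Nondeg w) (h : B.mk n z = B.mk m w) :
    ∃ e : n = m, ∃ a : G, ∀ i : Fin (n + 1), w.2 (Fin.cast (by rw [e]) i) = z.2 i ∧
      w.entry (Fin.cast (by rw [e]) i) =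
        a * z.entry i := by
  obtain ⟨a, ha⟩ := PreB.step_of_quot_eq h
  have ha' : ∀ y : ℝ, 0 ≤ y → y < 1 → PreB.step ⟨n, z⟩ y = a⁻¹ * PreB.step ⟨m, w⟩ y :=
    fun y h0 h1 => by rw [ha y h0 h1, inv_mul_cancel_left]
  obtain rfl : n = m := le_antisymm (hz.dim_le hw ha) (hw.dim_le hz ha')
  refine ⟨rfl, a, fun i => ?_⟩
  have e1 := hz.partialSum_eq hw ha i (by omega) (by omega)
  have e2 := hz.partialSum_eq hw ha (i + 1) (by omega) (by omega)
  have s1 := partialSum_succ z.2 i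
  have s2 := partialSum_succ w.2 i
  have p1 := pos_of_ne hz.1 i
  have p2 := pos_of_ne hw.1 i
  refine ⟨by simp only [Fin.cast_eq_self]; linarith, ?_⟩
  have h0 : 0 ≤ partialSum z.2 i := by
    rw [← partialSum_zero z.2]; exact partialSum_mono z.2 (Nat.zero_le i)
  have h1 : partialSum z.2 (i + 1) ≤ 1 :=
    (partialSum_mono z.2 (show i + 1 ≤ n + 1 by omega)).trans_eq (partialSum_of_le _ le_rfl)
  have e3 := Nondeg.step (z := z) (partialSum z.2 i) i le_rfl (by linarith)
  have e4 := Nondeg.step (z := w) (partialSum z.2 i) i e1.ge (by linarith)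
  rw [Fin.cast_eq_self, ← e3, ← e4]
  exact ha _ h0 (by linarith)

/-! ### Reduction of degenerate representatives -/

theorem B.mk_comp {m n : ℕ} (θ : Fin (m + 1) →o Fin (n + 1)) (g : Fin (n + 1) → G)
    (t : stdSimplex ℝ (Fin (m + 1))) :
    B.mk m (CompactCoherentification.mk _ (fun k => g (θ k)), t) =
      B.mk n (CompactCoherentification.mk _ g, stdSimplex.map θ t) :=
  Quot.sound (BRel.simplicial θ g t)

theorem B.mk_mul {n : ℕ} (a : G) (g : Fin (n + 1) → G) (t : stdSimplex ℝ (Fin (n + 1))) :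
    B.mk n (CompactCoherentification.mk _ (fun k => a * g k), t) =
      B.mk n (CompactCoherentification.mk _ g, t) :=
  (Quot.sound (BRel.translate a g t)).symm

theorem B.mk_zero (z : GSimplex G 0) :
    B.mk 0 z = B.pt G := by
  have h := B.mk_mul (z.entry 0)⁻¹
    z.entry z.2
  refine h.symm.trans ?_
  have e : (fun k => (z.entry 0)⁻¹ *
      z.entry k : Fin (0 + 1) → G) = fun _ => 1 := by
    funext k
    rw [Fin.fin_one_eq_zero k, inv_mul_cancel]
  rw [e, Subsingleton.elim z.2 (stdSimplex.vertex 0)]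
  rfl

theorem B.exists_pt : ∃ z, Nondeg z ∧ B.mk (G := G) 0 z = B.pt G :=
  ⟨(CompactCoherentification.mk _ fun _ => 1, stdSimplex.vertex 0),
    ⟨fun i => by simp, fun i j h => by omega⟩, B.mk_zero _⟩

/-- The entries of `z` are pulled back along the degeneracy merging positions `p` and `p + 1`, so
the simplicial relation merges their coordinates. -/
theorem B.mk_reduce_of_eq {n : ℕ} (p : Fin (n + 1))
    (z : GSimplex G (n + 1))
    (h : z.entry p.castSucc =
      z.entry p.succ) :
    B.mk n (reduce p.succ p z) = B.mk (n + 1) z := by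
  have e := B.mk_comp (p.predAboveOrderHom)
    (fun k => z.entry (p.succ.succAbove k)) z.2
  refine e.symm.trans (congrArg (fun g => B.mk (n + 1) (CompactCoherentification.mk _ g, z.2))
    (funext fun k => ?_))
  by_cases hk : k = p.succ
  · subst hk
    exact (congrArg z.entry (by simp)).trans h
  · exact congrArg z.entry (Fin.succ_succAbove_predAbove hk)

theorem stdSimplex_map_eq {n : ℕ} (e : Fin (n + 1) → Fin (n + 1)) (i : Fin (n + 1))
    (he : ∀ k, k ≠ i → e k = k) (t : stdSimplex ℝ (Fin (n + 1))) (hi : t i = 0) :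
    stdSimplex.map e t = t := by
  ext j
  rw [stdSimplex.map_coe, FunOnFinite.linearMap_apply_apply, Finset.sum_filter]
  have : ∀ k, (if e k = j then t k else 0) = if k = j then t k else 0 := by
    intro k
    by_cases hk : k = i
    · subst hk; simp [hi]
    · rw [he k hk]
  simp [this]

theorem exists_predAbove {n : ℕ} (i : Fin (n + 2)) :
    ∃ p : Fin (n + 1), ∀ k, k ≠ i → i.succAbove (p.predAbove k) = k := by
  refine i.cases ⟨0, fun k hk => ?_⟩ fun p => ⟨p, fun k hk => Fin.succ_succAbove_predAbove hk⟩
  obtain ⟨j, rfl⟩ := Fin.exists_succ_eq.2 hk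
  simp

/-- Here the simplicial relation is used for the `i`-th face map. Any `p` with this property will
do, since moving the zero coordinate does not change `z.2`; this keeps `reduce` of one form in both
cases. -/
theorem B.mk_reduce_of_zero {n : ℕ} (i : Fin (n + 2)) (p : Fin (n + 1))
    (hp : ∀ k, k ≠ i → i.succAbove (p.predAbove k) = k)
    (z : GSimplex G (n + 1))
    (h : z.2 i = 0) : B.mk n (reduce i p z) = B.mk (n + 1) z := by
  have hp' : ∀ k, k ≠ i → (i.succAboveOrderEmb.toOrderHom ∘ p.predAbove) k = k := hp
  have e := B.mk_comp (i.succAboveOrderEmb.toOrderHom)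
    z.entry (stdSimplex.map p.predAbove z.2)
  refine e.trans ?_
  rw [stdSimplex.map_comp_apply, stdSimplex_map_eq _ i hp' _ h]
  rfl

theorem B.exists_reduce {n : ℕ}
    (z : GSimplex G (n + 1))
    (hz : ¬ Nondeg z) : ∃ w, B.mk n w = B.mk (n + 1) z := by
  rw [Nondeg, not_and_or] at hz
  push Not at hz
  rcases hz with ⟨i, hi⟩ | ⟨i, j, hij, h⟩
  · obtain ⟨p, hp⟩ := exists_predAbove i
    exact ⟨_, B.mk_reduce_of_zero i p hp z hi⟩
  · refine ⟨_, B.mk_reduce_of_eq ⟨i, by omega⟩ z ?_⟩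
    exact h.trans (congrArg z.entry (Fin.ext hij))

theorem B.exists_nondeg {n : ℕ}
    (z : GSimplex G n) :
    ∃ m ≤ n, ∃ w, Nondeg w ∧ B.mk m w = B.mk n z := by
  induction n with
  | zero =>
    obtain ⟨w, hw, e⟩ := B.exists_pt (G := G)
    exact ⟨0, le_rfl, w, hw, e.trans (B.mk_zero z).symm⟩
  | succ n ih =>
    by_cases hz : Nondeg z
    · exact ⟨n + 1, le_rfl, z, hz, rfl⟩
    · obtain ⟨w, e⟩ := B.exists_reduce z hz
      obtain ⟨m, hm, w', hw', e'⟩ := ih w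
      exact ⟨m, by omega, w', hw', e'.trans e⟩

end Representatives

/-! ### The classifying space has a halo at its basepoint -/

/-! ### Homotopies on compactly generated products -/

section

variable {X : Type u} {Y : Type v} {K : Type w} [TopologicalSpace X] [TopologicalSpace Y]
  [TopologicalSpace K] [CompactSpace K] [LocallyCompactSpace K]

/-- After currying in `K`, continuity is tested on compact `C ⊆ X`. Then `C × K` is compact, and
maps out of compact spaces into `Y` remain continuous for the compactly generated topology. -/
theorem continuous_compactCoherentification_prod {f : X × K → Y} (hf : Continuous f) :
    Continuous fun p : CompactCoherentification X × K =>
      CompactCoherentification.mk Y (f ((CompactCoherentification.mk X).symm p.1, p.2)) := by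
  have h1 : ∀ x : CompactCoherentification X, Continuous fun k : K =>
      CompactCoherentification.mk Y (f ((CompactCoherentification.mk X).symm x, k)) := fun x =>
    CompactCoherentification.continuous_mk_comp_iff_of_compactSpace.2 (by fun_prop)
  have h2 : Continuous fun x => (⟨_, h1 x⟩ : C(K, CompactCoherentification Y)) := by
    rw [CompactCoherentification.continuous_dom_iff]
    intro C hC
    have := isCompact_iff_compactSpace.1 hC
    rw [continuousOn_iff_continuous_domRestrict]
    refine ContinuousMap.continuous_of_continuous_uncurry _ ?_
    exact CompactCoherentification.continuous_mk_comp_iff_of_compactSpace.2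
      (show Continuous fun p : C × K => f (p.1.1, p.2) by fun_prop)
  exact (continuous_eval (F := C(K, CompactCoherentification Y))).comp (h2.prodMap continuous_id)

end

theorem partialProd_continuous {G : Type u} [TopologicalSpace G] [Monoid G] [ContinuousMul G]
    {T : Type v} [TopologicalSpace T] {n : ℕ} (f : T → Fin n → G)
    (hf : ∀ i, Continuous fun x => f x i) (j : Fin (n + 1)) :
    Continuous fun x => Fin.partialProd (f x) j := by
  induction j using Fin.induction with
  | zero => simpa using continuous_const
  | succ j ih =>
    simp only [Fin.partialProd_succ]
    exact ih.mul (hf j)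

/-- The deformation of the standard simplex minus its barycentre away from the barycentre, as long
as all coordinates stay nonnegative. -/
def simplexPush {n : ℕ} (t : stdSimplex ℝ (Fin (n + 1))) (c : I)
    (h : ∀ i, (c : ℝ) ≤ 2 * (n + 1) * t i) : stdSimplex ℝ (Fin (n + 1)) :=
  -- The `i`-th coordinate vanishes exactly when `c = 2 (n + 1) t i`; the factor `2` keeps the
  -- denominator at least `1 / 2` for `c ≤ 1`.
  ⟨fun i => (t i - c / (2 * (n + 1))) / (1 - c / 2), fun i => by
    have h1 := c.2.2
    have h2 : (c : ℝ) / (2 * (n + 1)) ≤ t i := by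
      rw [div_le_iff₀ (by positivity)]; linarith [h i]
    exact div_nonneg (by linarith) (by linarith), by
    have h1 := c.2.2
    rw [← Finset.sum_div, Finset.sum_sub_distrib, stdSimplex.sum_eq_one]
    simp only [Finset.sum_const, Finset.card_univ, Fintype.card_fin, nsmul_eq_mul]
    rw [div_eq_one_iff_eq (by linarith)]
    push_cast
    field_simp⟩

/-! ### Deforming simplices of the classifying space to degenerate ones -/

section Cells

variable {G : Type u} [TopologicalSpace G]

/-- The point of the ordinary product underlying a point of `G^(n+1) × Δ^n`. -/
def GSimplex.unk {n : ℕ} (z : GSimplex G n) : (Fin (n + 1) → G) × stdSimplex ℝ (Fin (n + 1)) :=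
  (z.entry, z.2)

theorem GSimplex.continuous_unk {n : ℕ} : Continuous (GSimplex.unk (G := G) (n := n)) :=
  (CompactCoherentification.continuous_mk_symm.comp continuous_fst).prodMk continuous_snd

theorem nondeg_iff {G : Type u} {n : ℕ} (z : GSimplex G (n + 1)) :
    Nondeg z ↔ ¬ ((∃ i : Fin (n + 1), z.entry i.castSucc = z.entry i.succ) ∨ ∃ i, z.2 i = 0) := by
  rw [Nondeg, not_or, and_comm]
  push Not
  refine and_congr ⟨fun h i => h _ _ (by simp), fun h i j hij => ?_⟩ Iff.rfl
  have := h ⟨i, by omega⟩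
  rwa [show (⟨i, by omega⟩ : Fin (n + 1)).succ = j from Fin.ext hij.symm] at this

variable [Group G]

/-- The quotient of consecutive entries. -/
def ratio {n : ℕ} (g : Fin (n + 2) → G) (i : Fin (n + 1)) : G := (g i.castSucc)⁻¹ * g i.succ

/-- The time at which a point of `G^(n+2) × Δ^(n+1)` becomes degenerate. -/
def degTime (k : Halo G 1) {n : ℕ}
    (p : (Fin (n + 2) → G) × stdSimplex ℝ (Fin (n + 2))) : ℝ :=
  min (Finset.univ.inf' Finset.univ_nonempty fun i : Fin (n + 1) => k.u (ratio p.1 i))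
    (Finset.univ.inf' Finset.univ_nonempty fun i => 2 * ((n + 1 : ℕ) + 1) * p.2 i)

section

variable (k : Halo G 1) {n : ℕ} (p : (Fin (n + 2) → G) × stdSimplex ℝ (Fin (n + 2)))

theorem degTime_le_ratio (i : Fin (n + 1)) : degTime k p ≤ k.u (ratio p.1 i) :=
  (min_le_left _ _).trans (Finset.inf'_le _ (Finset.mem_univ i))

theorem degTime_le_coord (i : Fin (n + 2)) : degTime k p ≤ 2 * ((n + 1 : ℕ) + 1) * p.2 i :=
  (min_le_right _ _).trans (Finset.inf'_le _ (Finset.mem_univ i))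

theorem degTime_nonneg : 0 ≤ degTime k p := by
  refine le_min (Finset.le_inf' _ _ fun i _ => k.u_nonneg _) (Finset.le_inf' _ _ fun i _ => ?_)
  have := stdSimplex.zero_le p.2 i
  positivity

theorem degTime_attained : (∃ i, degTime k p = k.u (ratio p.1 i)) ∨
    ∃ i, degTime k p = 2 * ((n + 1 : ℕ) + 1) * p.2 i := by
  rcases min_choice (Finset.univ.inf' Finset.univ_nonempty fun i => k.u (ratio p.1 i))
    (Finset.univ.inf' Finset.univ_nonempty fun i => 2 * ((n + 1 : ℕ) + 1) * p.2 i) with h | h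
  · obtain ⟨i, -, hi⟩ := Finset.exists_mem_eq_inf' Finset.univ_nonempty
      fun i : Fin (n + 1) => k.u (ratio p.1 i)
    exact Or.inl ⟨i, h.trans hi⟩
  · obtain ⟨i, -, hi⟩ := Finset.exists_mem_eq_inf' Finset.univ_nonempty
      fun i : Fin (n + 2) => 2 * ((n + 1 : ℕ) + 1) * p.2 i
    exact Or.inr ⟨i, h.trans hi⟩

theorem min_clamp_le (s : I) : ((min s (clamp (degTime k p)) : I) : ℝ) ≤ degTime k p := by
  have h0 := degTime_nonneg k p
  refine (Subtype.coe_le_coe.2 (min_le_right _ _)).trans ?_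
  rw [clamp, Set.coe_projIcc]
  exact max_le h0 (min_le_right _ _)

/-- The deformation of the entries towards each other. -/
def entryPush (s : I) : Fin (n + 2) → G := fun j =>
  -- The first entry is kept and the others are rebuilt from the pushed ratios, which makes the
  -- formula equivariant under left translation. The minimum freezes the motion at the time of
  -- degeneration.
  p.1 0 * Fin.partialProd (fun i => k.D (ratio p.1 i, min s (clamp (degTime k p)))) j

/-- The deformation of the barycentric coordinates away from the barycentre. -/
def coordPush (s : I) : stdSimplex ℝ (Fin (n + 2)) :=
  simplexPush p.2 (min s (clamp (degTime k p))) fun i =>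
    (min_clamp_le k p s).trans (degTime_le_coord k p i)

theorem entryPush_zero : entryPush k p 0 = p.1 := by
  have h : min 0 (clamp (degTime k p)) = 0 := min_eq_left (clamp _).2.1
  have := Fin.partialProd_left_inv p.1
  funext j
  rw [entryPush, h]
  simp only [k.D_zero]
  exact congrFun this j

theorem coordPush_zero : coordPush k p 0 = p.2 := by
  have h : min 0 (clamp (degTime k p)) = 0 := min_eq_left (clamp _).2.1
  ext j
  change (p.2 j - ((min 0 (clamp (degTime k p)) : I) : ℝ) / _) /
    (1 - ((min 0 (clamp (degTime k p)) : I) : ℝ) / 2) = p.2 j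
  rw [h]
  simp

theorem degTime_mul (a : G) : degTime k ((fun j => a * p.1 j), p.2) = degTime k p := by
  simp [degTime, ratio, mul_assoc]

/-- Ratios are invariant under left translation, so the deformation descends to orbits; hence
trajectories do not depend on the nondegenerate representative. -/
theorem entryPush_mul (a : G) (s : I) :
    entryPush k ((fun j => a * p.1 j), p.2) s = fun j => a * entryPush k p s j := by
  funext j
  simp [entryPush, degTime_mul, ratio, mul_assoc]

theorem coordPush_mul (a : G) (s : I) :
    coordPush k ((fun j => a * p.1 j), p.2) s = coordPush k p s := by
  simp only [coordPush, degTime_mul]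

/-- Whichever term attains the minimum in `degTime` degenerates at that time. For a ratio, arrival
at `1` is needed at the time `u` itself, hence the hypothesis with `≤`. -/
theorem push_degenerate (hk : ∀ x (t : I), k.u x ≤ t → k.D (x, t) = 1) (h : degTime k p ≤ 1) :
    (∃ i : Fin (n + 1), entryPush k p (clamp (degTime k p)) i.castSucc =
      entryPush k p (clamp (degTime k p)) i.succ) ∨
    ∃ i, coordPush k p (clamp (degTime k p)) i = 0 := by
  have hc := coe_clamp (degTime_nonneg k p) h
  rcases degTime_attained k p with ⟨i, hi⟩ | ⟨i, hi⟩
  · refine Or.inl ⟨i, ?_⟩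
    rw [entryPush, entryPush, Fin.partialProd_succ, min_self, hk _ _ (by rw [hc, hi]), mul_one]
  · refine Or.inr ⟨i, ?_⟩
    change (p.2 i - ((min (clamp (degTime k p)) (clamp (degTime k p)) : I) : ℝ) /
      (2 * ((n + 1 : ℕ) + 1))) / _ = 0
    rw [min_self, hc, hi, mul_div_cancel_left₀ _ (by positivity), sub_self, zero_div]

theorem continuous_ratio [IsTopologicalGroup G] (i : Fin (n + 1)) :
    Continuous fun p : (Fin (n + 2) → G) × stdSimplex ℝ (Fin (n + 2)) => ratio p.1 i := by
  unfold ratio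
  fun_prop

theorem continuous_degTime [IsTopologicalGroup G] : Continuous (degTime k (n := n)) := by
  refine Continuous.min (Continuous.finset_inf'_apply _ fun i _ => ?_)
    (Continuous.finset_inf'_apply _ fun i _ => continuous_const.mul ?_)
  · exact k.u.continuous.comp (continuous_ratio i)
  · exact (continuous_apply i).comp (continuous_subtype_val.comp continuous_snd)

theorem continuous_min_clamp [IsTopologicalGroup G] :
    Continuous fun q : ((Fin (n + 2) → G) × stdSimplex ℝ (Fin (n + 2))) × I =>
      min q.2 (clamp (degTime k q.1)) :=
  continuous_snd.min (continuous_clamp.comp ((continuous_degTime k).comp continuous_fst))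

theorem continuous_entryPush [IsTopologicalGroup G] :
    Continuous fun q : ((Fin (n + 2) → G) × stdSimplex ℝ (Fin (n + 2))) × I =>
      entryPush k q.1 q.2 := by
  refine continuous_pi fun j => Continuous.mul (by fun_prop) (partialProd_continuous _ (fun i => ?_) j)
  exact k.D.continuous.comp (((continuous_ratio i).comp continuous_fst).prodMk
    (continuous_min_clamp k))

theorem continuous_coordPush [IsTopologicalGroup G] :
    Continuous fun q : ((Fin (n + 2) → G) × stdSimplex ℝ (Fin (n + 2))) × I =>
      coordPush k q.1 q.2 := by
  have hc : Continuous fun q : ((Fin (n + 2) → G) × stdSimplex ℝ (Fin (n + 2))) × I =>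
      ((min q.2 (clamp (degTime k q.1)) : I) : ℝ) :=
    continuous_subtype_val.comp (continuous_min_clamp k)
  refine Continuous.subtype_mk (continuous_pi fun i => Continuous.div (Continuous.sub ?_
    (hc.div_const _)) (continuous_const.sub (hc.div_const _))
    fun q (hq : 1 - ((min q.2 (clamp (degTime k q.1)) : I) : ℝ) / 2 = 0) => ?_) _
  · exact (continuous_apply i).comp (continuous_subtype_val.comp
      (continuous_snd.comp continuous_fst))
  · have := (min q.2 (clamp (degTime k q.1))).2.2
    linarith

end

/-- Postcomposition of a map that is continuous on `n`-simplices is continuous on degenerate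
`(n+1)`-simplices. -/
theorem continuous_degenerate {T : Type v} [TopologicalSpace T] {n : ℕ} (R : B G → T)
    (hR : Continuous fun z => R (B.mk n z)) [T2Space G] :
    Continuous fun a : {z : GSimplex G (n + 1) | ¬ Nondeg z} => R (B.mk (n + 1) a) := by
  have h1 : ∀ p : Fin (n + 1), ContinuousOn (fun z => R (B.mk (n + 1) z))
      {z : GSimplex G (n + 1) | z.entry p.castSucc = z.entry p.succ} := fun p =>
    (hR.comp (continuous_reduce p.succ p)).continuousOn.congr fun z hz =>
      congrArg R (B.mk_reduce_of_eq p z hz).symm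
  have h2 : ∀ i : Fin (n + 2), ContinuousOn (fun z => R (B.mk (n + 1) z))
      {z : GSimplex G (n + 1) | z.2 i = 0} := fun i => by
    obtain ⟨p, hp⟩ := exists_predAbove i
    exact (hR.comp (continuous_reduce i p)).continuousOn.congr fun z hz =>
      congrArg R (B.mk_reduce_of_zero i p hp z hz).symm
  have c1 : ∀ p : Fin (n + 1),
      IsClosed {z : GSimplex G (n + 1) | z.entry p.castSucc = z.entry p.succ} := fun p =>
    isClosed_eq (GSimplex.continuous_entry _) (GSimplex.continuous_entry _)
  have c2 : ∀ i : Fin (n + 2), IsClosed {z : GSimplex G (n + 1) | z.2 i = 0} := fun i =>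
    isClosed_eq (GSimplex.continuous_coord _) continuous_const
  have h3 := ((locallyFinite_of_finite _).continuousOn_iUnion c1 h1).union_of_isClosed
    ((locallyFinite_of_finite _).continuousOn_iUnion c2 h2) (isClosed_iUnion_of_finite c1)
    (isClosed_iUnion_of_finite c2)
  refine h3.comp_continuous continuous_subtype_val fun a => ?_
  have := a.2
  rw [Set.mem_ofPred_eq, nondeg_iff, not_not] at this
  simp only [Set.mem_union, Set.mem_iUnion]
  exact this

/-- The classifying space, built by attaching simplices of increasing dimensions. -/
def bCellSystem [IsTopologicalGroup G] [T2Space G] (k : Halo G 1)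
    (hk : ∀ x (t : I), k.u x ≤ t → k.D (x, t) = 1) : CellSystem.{u, 0, u} (B G) (B.pt G) where
  -- The cell with index `n` consists of the `(n + 1)`-simplices: all 0-simplices represent the
  -- basepoint and give no cell.
  ι := ℕ
  dim n := n
  Q n := GSimplex G (n + 1)
  q n := B.mk (n + 1)
  A n := {z | ¬ Nondeg z}
  u n := ⟨fun z => degTime k z.unk, (continuous_degTime k).comp GSimplex.continuous_unk⟩
  D n := ⟨fun p => (CompactCoherentification.mk _ (entryPush k p.1.unk p.2),
      coordPush k p.1.unk p.2), by
    refine Continuous.prodMk ?_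
      ((continuous_coordPush k).comp (GSimplex.continuous_unk.prodMap continuous_id))
    -- Reassociation makes `Δ^(n+1) × I` the compact factor next to the compactly generated power of
    -- `G`.
    have h := continuous_compactCoherentification_prod (K := stdSimplex ℝ (Fin (n + 2)) × I)
      ((continuous_entryPush k (n := n)).comp
        (Homeomorph.prodAssoc _ (stdSimplex ℝ (Fin (n + 2))) I).symm.continuous)
    exact h.comp (Homeomorph.prodAssoc _ (stdSimplex ℝ (Fin (n + 2))) I).continuous⟩
  u_nonneg n z := degTime_nonneg k _
  u_of_mem n z hz := by
    rw [Set.mem_ofPred_eq, nondeg_iff, not_not] at hz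
    refine le_antisymm ?_ (degTime_nonneg k _)
    rcases hz with ⟨i, hi⟩ | ⟨i, hi⟩
    · refine (degTime_le_ratio k _ i).trans_eq ?_
      have : ratio z.unk.1 i = 1 := by
        change (z.entry i.castSucc)⁻¹ * z.entry i.succ = 1
        rw [hi, inv_mul_cancel]
      rw [this, k.u_pt]
    · refine (degTime_le_coord k _ i).trans_eq ?_
      change _ * z.2 i = 0
      rw [hi, mul_zero]
  D_zero n z := by
    refine Prod.ext ?_ (coordPush_zero k _)
    exact congrArg (CompactCoherentification.mk _) (entryPush_zero k z.unk)
  D_mem n z hz := by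
    rw [Set.mem_ofPred_eq, nondeg_iff, not_not]
    exact push_degenerate k z.unk hk hz
  cover x hx := by
    obtain ⟨n, z⟩ := x
    obtain ⟨m, -, w, hw, e⟩ := B.exists_nondeg z
    cases m with
    | zero => exact absurd (e.symm.trans (B.mk_zero w)) hx
    | succ m => exact ⟨m, w, not_not.2 hw, e⟩
  ne_pt n z hz h := by
    obtain ⟨w, hw, e⟩ := B.exists_pt (G := G)
    obtain ⟨e', -⟩ := (not_not.1 hz).unique hw (h.trans e.symm)
    omega
  unique n m z hz w hw h := by
    obtain ⟨e, a, ha⟩ := (not_not.1 hz).unique (not_not.1 hw) h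
    obtain rfl : n = m := by omega
    simp only [Fin.cast_eq_self] at ha
    have h1 : w.unk = ((fun j => a * z.unk.1 j), z.unk.2) :=
      Prod.ext (funext fun i => (ha i).2) (stdSimplex.ext (funext fun i => (ha i).1))
    refine ⟨rfl, ?_, fun t => ?_⟩
    · simp only [ContinuousMap.coe_mk]
      rw [h1, degTime_mul]
    · simp only [ContinuousMap.coe_mk]
      rw [h1, entryPush_mul, coordPush_mul, B.mk_mul]
  boundary n a ha hx := by
    obtain ⟨w, e⟩ := B.exists_reduce a ha
    obtain ⟨m, hm, w', hw', e'⟩ := B.exists_nondeg w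
    cases m with
    | zero => exact absurd (e.symm.trans (e'.symm.trans (B.mk_zero w'))) hx
    | succ m => exact ⟨m, w', not_not.2 hw', e'.trans e, hm⟩
  continuous_boundary T _ R n hR := by
    apply continuous_degenerate
    cases n with
    | zero => simpa only [B.mk_zero] using continuous_const
    | succ n => exact hR n (Nat.lt_succ_self n)
  continuous_of_cells T _ R hR := by
    refine continuous_coinduced_dom.2 (continuous_sigma fun n => ?_)
    cases n with
    | zero =>
      have : Continuous fun z : GSimplex G 0 => R (B.mk 0 z) := by
        simpa only [B.mk_zero] using continuous_const
      exact this
    | succ n => exact hR n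

end Cells

/-- The classifying space of a CW-group has a halo at its basepoint. -/
theorem CWGrp.nonempty_halo_B (G : CWGrp.{u}) : Nonempty (Halo (B G) (B.pt G)) := by
  obtain ⟨k, hk⟩ := G.nonempty_halo
  exact (bCellSystem k hk).nonempty_halo

/-! ### Pointed and free homotopy classes on spaces with a halo -/

section Halo

variable {X : Type u} [TopologicalSpace X] {x₀ : X} {Y : Type v} [TopologicalSpace Y]

/-- Forgetting basepoints, on homotopy classes. -/
def forgetPt (x₀ : X) (y₀ : Y) : Htpy ({x₀} : Set X) y₀ → Htpy (∅ : Set X) y₀ :=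
  pre y₀ (.id X) (Set.mapsTo_empty _ _)

/-- A map sending `x₀` into the path component of the basepoint is homotopic to a pointed map. -/
theorem Halo.exists_forgetPt_eq (h : Halo X x₀) {y₀ : Y} (c : Maps (∅ : Set X) y₀)
    (γ : Path (c.1 x₀) y₀) : ∃ a, forgetPt x₀ y₀ a = Htpy.mk c := by
  have hD : ∀ x, h.u x ≤ 1 / 2 → h.D (x, 1) = x₀ := fun x hx =>
    h.D_of_lt x 1 (by simp only [Set.Icc.coe_one]; linarith)
  -- On `u ≤ 1 / 2` the final stage of the deformation is constantly `x₀`. There `c` is dragged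
  -- along `γ` up to time `1 - 2 u`, which is all of `γ` at `x₀` and nothing at `u = 1 / 2`.
  have hγ : Continuous fun p : I × X =>
      if h.u p.2 ≤ 1 / 2 then γ (clamp (p.1 * (1 - 2 * h.u p.2))) else c.1 (h.D (p.2, 1)) := by
    refine Continuous.if_le ?_ (by fun_prop) (by fun_prop) (by fun_prop) fun p hp => ?_
    · exact γ.continuous.comp (continuous_clamp.comp (by fun_prop))
    · rw [hD _ hp.le, hp]
      simp [clamp_zero]
  let f : Maps ({x₀} : Set X) y₀ :=
    ⟨⟨fun x => if h.u x ≤ 1 / 2 then γ (clamp (1 - 2 * h.u x)) else c.1 (h.D (x, 1)), by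
      refine (hγ.comp (Continuous.prodMk_right (1 : I))).congr fun x => ?_
      simp only [Function.comp_apply, Set.Icc.coe_one, one_mul]⟩, by
      rintro x rfl
      simp only [ContinuousMap.coe_mk, h.u_pt]
      rw [if_pos (by norm_num), mul_zero, sub_zero,
        show clamp 1 = 1 from Set.projIcc_right zero_le_one, γ.target]⟩
  refine ⟨Htpy.mk f, Eq.symm ?_⟩
  have h1 : Htpy.mk c = Htpy.mk (A := (∅ : Set X)) (y₀ := y₀)
      ⟨⟨fun x => c.1 (h.D (x, 1)), by fun_prop⟩, fun _ hx => hx.elim⟩ :=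
    Htpy.sound' (fun t x => c.1 (h.D (x, t))) (by fun_prop) (fun x => by rw [h.D_zero])
      (fun x => rfl) (fun _ _ hx => hx.elim)
  refine h1.trans (Htpy.sound' (fun t x => if h.u x ≤ 1 / 2 then
    γ (clamp (t * (1 - 2 * h.u x))) else c.1 (h.D (x, 1))) hγ (fun x => ?_) (fun x => ?_)
    (fun _ _ hx => hx.elim))
  · split_ifs with hx
    · simp [clamp_zero, hD x hx]
    · rfl
  · simp only [Set.Icc.coe_one, one_mul]
    rfl

/-- The composite of a pointed map with the final stage of the deformation. -/
def Halo.comp (h : Halo X x₀) {y₀ : Y} (f : Maps ({x₀} : Set X) y₀) : Maps ({x₀} : Set X) y₀ :=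
  ⟨⟨fun x => f.1 (h.D (x, 1)), by fun_prop⟩, by
    rintro x rfl
    simpa [h.D_pt] using f.2 x rfl⟩

theorem Halo.comp_apply (h : Halo X x₀) {y₀ : Y} (f : Maps ({x₀} : Set X) y₀) (x : X) :
    (h.comp f).1 x = f.1 (h.D (x, 1)) := rfl

theorem Halo.mk_comp (h : Halo X x₀) {y₀ : Y} (f : Maps ({x₀} : Set X) y₀) :
    Htpy.mk (h.comp f) = Htpy.mk f :=
  (Htpy.sound' (fun t x => f.1 (h.D (x, t))) (by fun_prop) (fun x => by rw [h.D_zero])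
    (fun x => rfl) (by rintro t x rfl; simpa [h.D_pt] using f.2 x rfl)).symm

/-- For maps into a loop space, free homotopy of pointed maps implies pointed homotopy. -/
theorem Halo.forgetPt_injective (h : Halo X x₀) (y₀ : Y) :
    Function.Injective (forgetPt x₀ (Path.refl y₀)) := by
  intro a b hab
  induction a using Htpy.ind with | h f => ?_
  induction b using Htpy.ind with | h g => ?_
  obtain ⟨H⟩ := Htpy.exact hab
  have H0 : ∀ x, H (0, x) = f.1 x := fun x => H.apply_zero x
  have H1 : ∀ x, H (1, x) = g.1 x := fun x => H.apply_one x
  -- The fraction of each loop to be traversed: none at `x₀`, and everything wherever the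
  -- deformation has not reached `x₀` by time `1`.
  let β : X → ℝ := fun x => min 1 (2 * h.u x)
  have hβ : Continuous β := by fun_prop
  have hβ0 : β x₀ = 0 := by simp [β, h.u_pt]
  have hβD : ∀ x, β x = 1 ∨ h.D (x, 1) = x₀ := by
    intro x
    rcases lt_or_ge (h.u x) 1 with hx | hx
    · exact Or.inr (h.D_of_lt x 1 (by simpa using hx))
    · exact Or.inl (min_eq_left (by linarith))
  -- Out along `H (t, D (x, 1))` up to parameter `β x`, then back along `H (t, x₀)`. The halves meet
  -- since either `β x = 1`, where both loops close up, or `D (x, 1) = x₀`, where they are the same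
  -- loop.
  let K : I × X → I → Y := fun p s =>
    if (s : ℝ) ≤ 1 / 2 then H (p.1, h.D (p.2, 1)) (clamp (2 * s * β p.2))
      else H (p.1, x₀) (clamp ((2 - 2 * s) * β p.2))
  have hK : Continuous fun q : (I × X) × I => K q.1 q.2 := by
    refine Continuous.if_le ?_ ?_ (by fun_prop) (by fun_prop) fun q hq => ?_
    · refine (continuous_eval (F := Path y₀ y₀)).comp (Continuous.prodMk
        (H.continuous.comp (by fun_prop)) (continuous_clamp.comp (by fun_prop)))
    · refine (continuous_eval (F := Path y₀ y₀)).comp (Continuous.prodMk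
        (H.continuous.comp (by fun_prop)) (continuous_clamp.comp (by fun_prop)))
    · rw [hq]
      rcases hβD q.1.2 with e | e
      · rw [e]
        norm_num [show clamp 1 = 1 from Set.projIcc_right zero_le_one]
      · rw [e]
        norm_num
  -- At the ends of the homotopy the loop over `x₀` is constant, so the way back is trivial. The
  -- truncation by `β` is harmless too, because `β x ≠ 1` makes the outgoing loop constant.
  have key : ∀ (t : I) (k : Maps ({x₀} : Set X) (Path.refl y₀)),
      (∀ x, H (t, x) = k.1 x) → ∀ (x : X) (s : I), K (t, x) s =
        if (s : ℝ) ≤ 1 / 2 then k.1 (h.D (x, 1)) (clamp (2 * s)) else y₀ := by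
    intro t k hk x s
    have hk0 : k.1 x₀ = Path.refl y₀ := k.2 x₀ rfl
    simp only [K, hk, hk0]
    split_ifs
    · rcases hβD x with e | e
      · rw [e, mul_one]
      · rw [e, hk0]; rfl
    · rfl
  have concat : ∀ (k : Maps ({x₀} : Set X) (Path.refl y₀)) (x : X) (s : I),
      ((h.comp k).concat (Maps.const _ _)).1 x s =
        if (s : ℝ) ≤ 1 / 2 then k.1 (h.D (x, 1)) (clamp (2 * s)) else y₀ := by
    intro k x s
    simp only [Maps.concat, ContinuousMap.coe_mk, Path.trans_apply, h.comp_apply]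
    split_ifs with hs
    · congr 1
      exact Subtype.ext (coe_clamp (by linarith [s.2.1]) (by linarith)).symm
    · rfl
  rw [← h.mk_comp f, ← h.mk_comp g, ← add_zero (Htpy.mk (h.comp f)), Htpy.zero_def, Htpy.mk_add,
    ← add_zero (Htpy.mk (h.comp g)), Htpy.zero_def, Htpy.mk_add]
  refine Htpy.sound' (fun t x =>
    { toFun := K (t, x)
      continuous_toFun := hK.comp (Continuous.prodMk_right (t, x))
      source' := by simp [K, clamp_zero]
      target' := by norm_num [K, clamp_zero] }) (Path.continuous_uncurry_iff.mp hK)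
    (fun x => Path.ext (funext fun s => (key 0 f H0 x s).trans (concat f x s).symm))
    (fun x => Path.ext (funext fun s => (key 1 g H1 x s).trans (concat g x s).symm)) ?_
  rintro t x rfl
  ext s
  simp [K, hβ0, clamp_zero]

end Halo

/-! ### The split exact sequence -/

namespace OmegaSpectrum

variable (F : OmegaSpectrum.{v}) (d : ℤ) {X : Type u} [TopologicalSpace X]

theorem zero_eq_mk (A : Set X) : (0 : F.Coh d A) = Htpy.mk (Maps.const A (F.pt d)) := by
  apply (F.deloop d A).injective
  refine ((F.deloop d A).apply_symm_apply (0 : Htpy A (Path.refl (F.pt (d + 1))))).trans ?_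
  exact congrArg Htpy.mk (Subtype.ext (ContinuousMap.ext fun _ => (F.isEquiv d).map_pt.symm))

/-- `deloop` commutes with forgetting basepoints, so the question moves to maps into a loop space.
-/
theorem forget_injective {x₀ : X} (h : Halo X x₀) : Function.Injective (F.forget d x₀) := by
  have key : ∀ a : F.Reduced d X x₀, F.deloop d ∅ (F.forget d x₀ a) =
      forgetPt x₀ (Path.refl (F.pt (d + 1))) (F.deloop d {x₀} a) := fun a => by
    induction a using Htpy.ind with
    | h f => rfl
  intro a b hab
  apply (F.deloop d {x₀}).injective
  apply h.forgetPt_injective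
  rw [← key, ← key, hab]

/-- Allowing any space `E` with a point, mapped constantly to `x₀`, covers restriction to `B0` and
to `pt` at once. -/
theorem exact_forget {x₀ : X} (h : Halo X x₀) {E : Type w} [TopologicalSpace E] (k : C(E, X))
    (e₀ : E) (hk : ∀ e, k e = x₀) :
    Function.Exact (F.forget d x₀) (F.unreducedMap d k) := by
  intro x
  constructor
  · intro hx
    induction x using Htpy.ind with | h c => ?_
    obtain ⟨H⟩ := Htpy.exact (hx.trans (F.zero_eq_mk d ∅))
    -- The track of `e₀` under the null-homotopy.
    have γ : Path (c.1 x₀) (F.pt d) :=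
      { toFun := fun t => H (t, e₀)
        continuous_toFun := by fun_prop
        source' := (H.apply_zero e₀).trans (congrArg c.1 (hk e₀))
        target' := H.apply_one e₀ }
    exact h.exists_forgetPt_eq c γ
  · rintro ⟨a, rfl⟩
    induction a using Htpy.ind with | h f => ?_
    refine Eq.trans ?_ (F.zero_eq_mk d ∅).symm
    refine congrArg Htpy.mk (Subtype.ext (ContinuousMap.ext fun e => ?_))
    exact (congrArg f.1 (hk e)).trans (f.2 x₀ rfl)

theorem unreducedMap_comp {X' : Type u} [TopologicalSpace X'] {X'' : Type w} [TopologicalSpace X'']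
    (f : C(X', X)) (g : C(X'', X')) :
    (F.unreducedMap d g).comp (F.unreducedMap d f) = F.unreducedMap d (f.comp g) := by
  ext x
  induction x using Htpy.ind with
  | h c => rfl

end OmegaSpectrum

/-! ### Split exact sequences of abelian groups -/

/-- The isomorphism determined by a split exact sequence of abelian groups. -/
theorem exists_split_equiv {R U P : Type*} [AddCommGroup R] [AddCommGroup U] [AddCommGroup P]
    (i : R →+ U) (p : U →+ P) (s : P →+ U) (hi : Function.Injective i)
    (hip : Function.Exact i p) (hps : p.comp s = AddMonoidHom.id P) :
    ∃ e : U ≃+ R × P, (∀ x, (e x).2 = p x) ∧ ∀ a b, e.symm (a, b) = i a + s b := by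
  have hps' : ∀ b, p (s b) = b := DFunLike.congr_fun hps
  have hpi : ∀ a, p (i a) = 0 := hip.apply_apply_eq_zero
  let f : R × P →+ U := i.coprod s
  have hf : ∀ y, p (f y) = y.2 := fun y => by simp [f, hpi, hps']
  have hb : Function.Bijective f := by
    constructor
    · rw [injective_iff_map_eq_zero]
      rintro ⟨a, b⟩ h
      have hb : b = 0 := by simpa [h] using (hf (a, b)).symm
      subst hb
      have ha : i a = 0 := by simpa [f] using h
      rw [(injective_iff_map_eq_zero i).1 hi a ha]
      rfl
    · intro x
      obtain ⟨a, ha⟩ := (hip (x - s (p x))).1 (by simp [hps'])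
      exact ⟨(a, p x), by simp [f, ha]⟩
  let e := AddEquiv.ofBijective f hb
  refine ⟨e.symm, fun x => ?_, fun a b => by simp [e, f]⟩
  rw [← hf, ← AddEquiv.ofBijective_apply f hb, e.apply_symm_apply]

/-- Naturality of the isomorphisms determined by split exact sequences. -/
theorem split_equiv_natural {R U R' U' P : Type*} [AddCommGroup R] [AddCommGroup U]
    [AddCommGroup R'] [AddCommGroup U'] [AddCommGroup P]
    {i : R →+ U} {s : P →+ U} {i' : R' →+ U'} {s' : P →+ U'} (e : U ≃+ R × P) (e' : U' ≃+ R' × P)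
    (he : ∀ a b, e.symm (a, b) = i a + s b) (he' : ∀ a b, e'.symm (a, b) = i' a + s' b)
    (fR : R →+ R') (fU : U →+ U') (hi : i'.comp fR = fU.comp i) (hs : fU.comp s = s') (x : U) :
    e' (fU x) = (fR (e x).1, (e x).2) := by
  rw [← AddEquiv.eq_symm_apply, he']
  obtain ⟨⟨a, b⟩, rfl⟩ := e.symm.surjective x
  rw [e.apply_symm_apply, he, map_add, ← hs]
  exact congrArg (· + _) (DFunLike.congr_fun hi a).symm

/-! ### The classifying space of the trivial group and functoriality of `B` -/

instance : Subsingleton (B CWGrp.zero.{u}) := by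
  refine ⟨fun x y => ?_⟩
  have key : ∀ x : B CWGrp.zero.{u}, x = B.pt _ := by
    rintro ⟨n, g, t⟩
    refine Eq.trans ?_ (B.mk_zero (CompactCoherentification.mk _ (fun _ => 1),
      stdSimplex.map (fun _ => 0) t))
    -- Over the trivial group every simplex is pulled back from a 0-simplex along `[n] → [0]`, so it
    -- collapses to the vertex.
    exact B.mk_comp (⟨fun _ => 0, fun _ _ _ => le_rfl⟩ : Fin (n + 1) →o Fin (0 + 1))
      (fun _ => (1 : CWGrp.zero.{u})) t
  rw [key x, key y]

theorem B.map_comp {G G' G'' : Type u} [Group G] [TopologicalSpace G] [Group G']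
    [TopologicalSpace G'] [Group G''] [TopologicalSpace G''] (φ : G →ₜ* G') (ψ : G' →ₜ* G'') :
    (B.map ψ).comp (B.map φ) = B.map (ψ.comp φ) := by
  ext ⟨x⟩
  rfl

/-- The map `B φ` for the trivial homomorphism `φ` out of the trivial group is constant. -/
theorem B.map_zero_apply (G : CWGrp.{u}) (φ : CWGrp.zero.{u} →ₜ* G) (x : B CWGrp.zero.{u}) :
    B.map φ x = B.pt G := by
  rw [Subsingleton.elim x (B.pt _), B.map_pt]

end GenCoh

end

/-! ### The main theorem -/

theorem mainTheorem2 (F : GenCoh.OmegaSpectrum.{v}) (d : ℤ) :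
    -- for every `G`, the sequence `0 → h̃^d(BG) → h^d(BG) → h^d(B0) → 0` is exact and `s` splits it
    (∀ G : GenCoh.CWGrp.{u},
      Function.Injective (F.iMap d G) ∧
      Function.Exact (F.iMap d G) (F.pMap d G) ∧
      Function.Surjective (F.pMap d G) ∧
      (F.pMap d G).comp (F.sMap d G) = AddMonoidHom.id _) ∧
    -- `i`, `p` and `s` are natural in `G`
    (∀ (G' G : GenCoh.CWGrp.{u}) (φ : G' →ₜ* G),
      (F.iMap d G').comp (F.reducedB d φ) = (F.unreducedB d φ).comp (F.iMap d G) ∧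
      (F.pMap d G').comp (F.unreducedB d φ) = F.pMap d G ∧
      (F.unreducedB d φ).comp (F.sMap d G) = F.sMap d G') ∧
    -- the resulting natural isomorphism `h^d(BG) ≅ h̃^d(BG) ⊕ h^d(B0)`
    (∃ e : ∀ G : GenCoh.CWGrp.{u}, F.Unreduced d (GenCoh.B G) ≃+
        F.Reduced d (GenCoh.B G) (GenCoh.B.pt G) ×
          F.Unreduced d (GenCoh.B GenCoh.CWGrp.zero.{u}),
      (∀ G x, (e G x).2 = F.pMap d G x) ∧
      (∀ G a b, (e G).symm (a, b) = F.iMap d G a + F.sMap d G b) ∧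
      (∀ (G' G : GenCoh.CWGrp.{u}) (φ : G' →ₜ* G) (x : F.Unreduced d (GenCoh.B G)),
        e G' (F.unreducedB d φ x) = (F.reducedB d φ (e G x).1, (e G x).2))) ∧
    -- the same with `h^d(pt)` in place of `h^d(B0)`
    (∃ e : ∀ G : GenCoh.CWGrp.{u}, F.Unreduced d (GenCoh.B G) ≃+
        F.Reduced d (GenCoh.B G) (GenCoh.B.pt G) × F.Unreduced d Unit,
      (∀ G x, (e G x).2 = F.restrictPt d G x) ∧
      (∀ G a b, (e G).symm (a, b) = F.iMap d G a + F.inflatePt d G b) ∧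
      (∀ (G' G : GenCoh.CWGrp.{u}) (φ : G' →ₜ* G) (x : F.Unreduced d (GenCoh.B G)),
        e G' (F.unreducedB d φ x) = (F.reducedB d φ (e G x).1, (e G x).2))) := by
  have hinj : ∀ G : GenCoh.CWGrp.{u}, Function.Injective (F.iMap d G) := fun G =>
    F.forget_injective d G.nonempty_halo_B.some
  have hex : ∀ G : GenCoh.CWGrp.{u}, Function.Exact (F.iMap d G) (F.pMap d G) := fun G =>
    F.exact_forget d G.nonempty_halo_B.some _ (GenCoh.B.pt _) (GenCoh.B.map_zero_apply G _)
  have hex' : ∀ G : GenCoh.CWGrp.{u}, Function.Exact (F.iMap d G) (F.restrictPt d G) := fun G =>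
    F.exact_forget d G.nonempty_halo_B.some _ () fun _ => rfl
  have hps : ∀ G : GenCoh.CWGrp.{u},
      (F.pMap d G).comp (F.sMap d G) = AddMonoidHom.id _ := fun G => by
    refine (F.unreducedMap_comp d _ _).trans ?_
    ext x
    induction x using GenCoh.Htpy.ind with | h c => ?_
    refine congrArg GenCoh.Htpy.mk (Subtype.ext (ContinuousMap.ext fun y => ?_))
    -- Every self-map of the one-point space `B0` is the identity.
    exact congrArg c.1 (Subsingleton.elim _ _)
  have hps' : ∀ G : GenCoh.CWGrp.{u},
      (F.restrictPt d G).comp (F.inflatePt d G) = AddMonoidHom.id _ := fun G => by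
    ext x
    induction x using GenCoh.Htpy.ind with
    | h c => rfl
  have hnat : ∀ (G' G : GenCoh.CWGrp.{u}) (φ : G' →ₜ* G),
      (F.iMap d G').comp (F.reducedB d φ) = (F.unreducedB d φ).comp (F.iMap d G) ∧
      (F.pMap d G').comp (F.unreducedB d φ) = F.pMap d G ∧
      (F.unreducedB d φ).comp (F.sMap d G) = F.sMap d G' := fun G' G φ => by
    refine ⟨?_, ?_, ?_⟩
    · ext x
      induction x using GenCoh.Htpy.ind with
      | h c => rfl
    · refine (F.unreducedMap_comp d _ _).trans (congrArg (F.unreducedMap d) ?_)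
      rw [GenCoh.B.map_comp]
      exact congrArg _ (ContinuousMonoidHom.ext fun _ => map_one φ)
    · refine (F.unreducedMap_comp d _ _).trans (congrArg (F.unreducedMap d) ?_)
      rw [GenCoh.B.map_comp]
      rfl
  have hinf : ∀ (G' G : GenCoh.CWGrp.{u}) (φ : G' →ₜ* G),
      (F.unreducedB d φ).comp (F.inflatePt d G) = F.inflatePt d G' := fun G' G φ => by
    ext x
    induction x using GenCoh.Htpy.ind with
    | h c => rfl
  refine ⟨fun G => ⟨hinj G, hex G, fun b => ⟨F.sMap d G b, DFunLike.congr_fun (hps G) b⟩, hps G⟩,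
    hnat, ?_, ?_⟩
  · choose e he₁ he₂ using fun G => GenCoh.exists_split_equiv _ _ _ (hinj G) (hex G) (hps G)
    exact ⟨e, he₁, he₂, fun G' G φ x => GenCoh.split_equiv_natural (e G) (e G') (he₂ G) (he₂ G') _ _
      (hnat G' G φ).1 (hnat G' G φ).2.2 x⟩
  · choose e he₁ he₂ using fun G => GenCoh.exists_split_equiv _ _ _ (hinj G) (hex' G) (hps' G)
    exact ⟨e, he₁, he₂, fun G' G φ x => GenCoh.split_equiv_natural (e G) (e G') (he₂ G) (he₂ G') _ _
      (hnat G' G φ).1 (hinf G' G φ) x⟩
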